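/- For a prime $p$, a subgroup $\mathcal G\subseteq\mathbb F_p^*$ and a real number $H>0$, let $\mathcal U(p;\mathcal G,H)$ be the set of $u\in\mathbb F_p$ for which the congruence $v\equiv u+x \pmod p$ has no solution with $v\in\mathcal G$ and an integer $x$ with $0\le x<H$. Let $\nu\ge 1$ be a fixed integer. Then for every prime $p$, every subgroup $\mathcal G\subseteq\mathbb F_p^*$ of order $t>p^{1/2}$ and every real $H>0$, $$\#\,\mathcal U(p;\mathcal G,H)\le p^{2-\frac{1}{4(\nu+1)}+o(1)}H^{-1/2}t^{-\frac54+\frac{2\nu+1}{4\nu(\nu+1)}}+p^{\frac52-\frac1{2\nu}+o(1)}H^{-1}t^{-\frac54+\frac1{2\nu}},$$ where $o(1)$ denotes a quantity that depends only on $\nu$ and $p$ and, for fixed $\nu$, tends to $0$ as $p\to\infty$ (so it is uniform in $\mathcal G$ and $H$). -/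

import Mathlib

open Filter Topology

/-- The set of residues `u` modulo `p` for which the congruence `v ≡ u + x (mod p)` has no solution
with `v ∈ G` and an integer `x` with `0 ≤ x < H`. -/
def avoidingSet (p : ℕ) (G : Subgroup (ZMod p)ˣ) (H : ℝ) : Set (ZMod p) :=
  {u | ¬ ∃ v ∈ G, ∃ x : ℤ, 0 ≤ x ∧ (x : ℝ) < H ∧ (v : ZMod p) = u + (x : ZMod p)}

/-!
Write `t` for the order of `G`, `S(a)` for the sum of `e(a v / p)` over `v ∈ G`, `M = ⌈H⌉`, and `D(a)`
for the sum of `e(a x / p)` over `0 ≤ x < M`. If `U` is the avoiding set, then no triple `(u, x, v)`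
satisfies `v = u + x`; expanding this count in additive characters and applying Cauchy–Schwarz gives
`#U * t ^ 2 * M ^ 2 ≤ p * ∑ a ≠ 0, |S(a)| ^ 2 * |D(a)| ^ 2` (`card_sq_mul_le_of_forall_ne`). Since `S`
is constant on cosets of `G`, a second application of Cauchy–Schwarz (`card_mul_sum_sq_le`) separates
the fourth moment of `S` from the correlation `∑ g ∈ G, ∑ a ≠ 0, |D(a)| ^ 2 * |D(g a)| ^ 2`.

The fourth moment is `O(p * t ^ (5 / 2))` (`sum_norm_expSum_residues_pow_four_le`). For `t` above
`p ^ (2 / 3)` this follows from `|S(a)| ≤ √p`. Below, it is the Heath-Brown–Konyagin bound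
`O(t ^ (5 / 2))` for the additive energy of `G`, proved by Stepanov's method
(`Stepanov.card_mul_le`): a polynomial in `X`, `X ^ t` and `(X - 1) ^ t` that vanishes to high order at
all `w` with `w ^ t = 1` for which `(w - 1) ^ t` lies in a given small set. It is nonzero because a
polynomial of degree less than `p` with at most `n` terms cannot vanish to order `n` at `1`.

As `|D(a)| ≤ min(M, p / |a|)`, the correlation is governed by the number of pairs `(g, a)` for which
`a` and `g a` are both small, that is by the number of reduced fractions `y / x` of small height whose
residue lies in `±G`. Two facts bound it. First, a `k`-fold product set of fractions of height `m`
consists of fractions of height `m ^ k`, and it has nearly as many elements as there are `k`-tuples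
(`card_fractionsIn_pow_le`): numerator and denominator have only `p ^ o(1)` divisors, so cancellation
costs little. Second, the fractions of height `Z` in a fixed residue class are spaced by `p / Z ^ 2`,
hence number `O(1 + Z ^ 2 / p)` (`card_le_of_dvd_det`). Choosing `k` according to the size of `m`, or
taking the geometric mean of the bounds for `k` and `k + 1`, gives `exists_card_fractionsIn_le`; here
`t > p ^ (1 / 2)` enters.
-/

open Polynomial Finset

/-! ### Sparse polynomials and the operator `X (X - 1) d/dX` -/

/-- A polynomial of degree below the characteristic with at most `n` nonzero coefficients and a zero
of order `n` at `1` vanishes. -/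
theorem Polynomial.eq_zero_of_X_sub_one_pow_dvd {F : Type*} [Field F] (p : ℕ) [CharP F p]
    (n : ℕ) : ∀ f : F[X], #f.support ≤ n → f.natDegree < p → (X - 1) ^ n ∣ f → f = 0 := by
  induction n with
  | zero =>
    intro f hs _ _
    simpa using hs
  | succ n ih =>
    intro f hs hdeg hdvd
    by_contra hf
    obtain ⟨g, hg, hndvd⟩ := exists_eq_pow_rootMultiplicity_mul_and_not_dvd f hf 0
    set m := rootMultiplicity 0 f
    rw [C_0, sub_zero] at hg hndvd
    have hg0 : g.coeff 0 ≠ 0 := fun h ↦ hndvd (X_dvd_iff.2 h)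
    have hgne : g ≠ 0 := by rintro rfl; simp at hg0
    have hgdeg : g.natDegree < p := by
      have : f.natDegree = m + g.natDegree := by
        rw [hg, natDegree_mul (pow_ne_zero _ X_ne_zero) hgne, natDegree_X_pow]
      omega
    have hgs : #g.support ≤ n + 1 := by
      refine le_trans ?_ hs
      refine card_le_card_of_injOn (· + m) (fun i hi ↦ ?_) (fun _ _ _ _ h ↦ by simpa using h)
      have : f.coeff (i + m) = g.coeff i := by rw [hg, coeff_X_pow_mul]
      simpa [mem_support_iff, this] using hi
    have hcop : IsCoprime ((X - 1 : F[X]) ^ (n + 1)) (X ^ m) := by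
      apply IsCoprime.pow
      exact ⟨-1, 1, by ring⟩
    have hgdvd : (X - 1) ^ (n + 1) ∣ g := hcop.dvd_of_dvd_mul_left (hg ▸ hdvd)
    have hder : derivative g = 0 := by
      apply ih
      · have h1 : #(g.support.erase 0) ≤ n := by
          rw [card_erase_of_mem (mem_support_iff.2 hg0)]; omega
        refine le_trans ?_ h1
        refine card_le_card_of_injOn (· + 1) (fun i hi ↦ ?_) (fun _ _ _ _ h ↦ by simpa using h)
        have : g.coeff (i + 1) ≠ 0 := by
          intro h0
          simp [mem_support_iff, coeff_derivative, h0] at hi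
        simpa [mem_support_iff] using this
      · exact lt_of_le_of_lt (natDegree_derivative_le g |>.trans (Nat.sub_le _ _)) hgdeg
      · obtain ⟨q, rfl⟩ := hgdvd
        rw [derivative_mul, derivative_pow]
        refine dvd_add (Dvd.dvd.mul_right (Dvd.dvd.mul_right (Dvd.dvd.mul_left ?_ _) _) _)
          (Dvd.dvd.mul_right ?_ _)
        · simp
        · exact pow_dvd_pow _ (Nat.le_succ n)
    have hconst : g = C (g.coeff 0) := by
      ext i
      rcases i with _ | i
      · simp
      · rw [coeff_C_succ]
        by_cases hi : i + 1 < p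
        · have h1 : (derivative g).coeff i = 0 := by rw [hder, coeff_zero]
          rw [coeff_derivative] at h1
          rcases mul_eq_zero.1 h1 with h | h
          · exact h
          · exfalso
            have : ((i + 1 : ℕ) : F) = 0 := by exact_mod_cast h
            rw [CharP.cast_eq_zero_iff F p] at this
            exact absurd (Nat.le_of_dvd (Nat.succ_pos i) this) (by omega)
        · exact coeff_eq_zero_of_natDegree_lt (by omega)
    obtain ⟨q, hq⟩ := hgdvd
    have := congrArg (eval 1) hq
    rw [hconst] at this
    simp at this
    exact hg0 this

namespace Stepanov

variable {F : Type*} [Field F]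

/-- The differential operator `X (X - 1) d/dX`. -/
noncomputable def eulerOp : F[X] →ₗ[F] F[X] :=
  (LinearMap.mulLeft F (X * (X - 1))).comp derivative

/-- The conjugate of `X (X - 1) d/dX` by multiplication with `X ^ b * (X - 1) ^ c`. -/
noncomputable def twistedOp (b c : ℕ) : F[X] →ₗ[F] F[X] :=
  eulerOp + LinearMap.mulLeft F ((b : F[X]) * (X - 1) + (c : F[X]) * X)

theorem eulerOp_apply (f : F[X]) : eulerOp f = X * (X - 1) * derivative f := rfl

theorem twistedOp_apply (b c : ℕ) (f : F[X]) :
    twistedOp b c f = X * (X - 1) * derivative f + ((b : F[X]) * (X - 1) + (c : F[X]) * X) * f := rfl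

theorem eulerOp_mul (b c : ℕ) (f : F[X]) :
    eulerOp (f * (X ^ b * (X - 1) ^ c)) = twistedOp b c f * (X ^ b * (X - 1) ^ c) := by
  have hb : (X : F[X]) * derivative (X ^ b : F[X]) = (b : F[X]) * X ^ b := by
    rcases b with _ | b
    · simp
    · simp; ring
  have hc : (X - 1 : F[X]) * derivative ((X - 1) ^ c : F[X]) = (c : F[X]) * (X - 1) ^ c := by
    rcases c with _ | c
    · simp
    · simp [derivative_pow]; ring
  rw [eulerOp_apply, twistedOp_apply, derivative_mul, derivative_mul]
  linear_combination (X - 1) * (X - 1) ^ c * f * hb + X * X ^ b * f * hc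

theorem eulerOp_iterate_mul (b c n : ℕ) (f : F[X]) :
    eulerOp^[n] (f * (X ^ b * (X - 1) ^ c)) = (twistedOp b c)^[n] f * (X ^ b * (X - 1) ^ c) := by
  induction n generalizing f with
  | zero => rfl
  | succ n ih => rw [Function.iterate_succ_apply, eulerOp_mul, ih, Function.iterate_succ_apply]

theorem natDegree_twistedOp_le (b c : ℕ) (f : F[X]) :
    (twistedOp b c f).natDegree ≤ f.natDegree + 1 := by
  rw [twistedOp_apply]
  refine natDegree_add_le_of_degree_le ?_ ?_
  · by_cases h : f.natDegree = 0
    · rw [eq_C_of_natDegree_eq_zero h]; simp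
    · have h1 : (X * (X - 1) : F[X]).natDegree ≤ 2 := by compute_degree
      have h2 := natDegree_derivative_le f
      exact natDegree_mul_le.trans (by omega)
  · have h1 : ((b : F[X]) * (X - 1) + (c : F[X]) * X).natDegree ≤ 1 := by compute_degree
    exact natDegree_mul_le.trans (by omega)

theorem natDegree_twistedOp_iterate_le (b c n : ℕ) (f : F[X]) :
    ((twistedOp b c)^[n] f).natDegree ≤ f.natDegree + n := by
  induction n generalizing f with
  | zero => simp
  | succ n ih =>
    rw [Function.iterate_succ_apply]
    have := ih (twistedOp b c f)
    have := natDegree_twistedOp_le b c f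
    omega

/-- If the first `D ≤ p` iterates of `X (X - 1) d/dX` of `f` vanish at `w`, then `f` has a zero of
order at least `D` there. -/
theorem pow_dvd_of_eval_eulerOp_iterate (p : ℕ) [CharP F p] {w : F} (hw0 : w ≠ 0) (hw1 : w ≠ 1)
    (D : ℕ) : ∀ f : F[X], D ≤ p → (∀ n < D, eval w (eulerOp^[n] f) = 0) → (X - C w) ^ D ∣ f := by
  induction D with
  | zero => intro f _ _; simp
  | succ D ih =>
    intro f hD h
    by_cases hf : f = 0
    · simp [hf]
    have h1 : (X - C w) ^ D ∣ eulerOp f := ih _ (by omega) fun n hn ↦ by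
      have := h (n + 1) (by omega)
      rwa [Function.iterate_succ_apply] at this
    have hcop : IsCoprime ((X - C w) ^ D) (X * (X - 1)) := by
      apply IsCoprime.pow_left
      apply IsCoprime.mul_right
      · simpa using isCoprime_X_sub_C_of_isUnit_sub (a := w) (b := 0) (by simpa using hw0)
      · simpa using isCoprime_X_sub_C_of_isUnit_sub (a := w) (b := 1)
          (by simpa [sub_eq_zero] using hw1)
    rw [eulerOp_apply] at h1
    have h2 : (X - C w) ^ D ∣ derivative f := hcop.dvd_of_dvd_mul_left h1
    obtain ⟨g, hg, hndvd⟩ := exists_eq_pow_rootMultiplicity_mul_and_not_dvd f hf w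
    set m := rootMultiplicity w f with hm
    have hm0 : 0 < m := (rootMultiplicity_pos hf).2 (by simpa using h 0 (by omega))
    by_contra hcon
    have hmD : m < D + 1 := by
      by_contra hge
      exact hcon ((pow_dvd_pow _ (not_lt.1 hge)).trans ⟨g, hg⟩)
    obtain ⟨k, hk⟩ : ∃ k, m = k + 1 := ⟨m - 1, by omega⟩
    have h3 : (X - C w) ^ m ∣ derivative f := (pow_dvd_pow _ (by omega)).trans h2
    rw [hg, derivative_mul, derivative_pow, hk] at h3
    have h4 : (X - C w) ^ (k + 1) ∣ (X - C w) ^ k * (((k + 1 : ℕ) : F[X]) * g) := by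
      have h5 := dvd_sub h3 (Dvd.intro (derivative g) rfl)
      convert h5 using 1
      simp
      ring
    rw [pow_succ, mul_dvd_mul_iff_left (pow_ne_zero _ (X_sub_C_ne_zero w))] at h4
    rw [dvd_iff_isRoot, IsRoot, eval_mul, mul_eq_zero] at h4
    rcases h4 with h4 | h4
    · rw [eval_natCast, CharP.cast_eq_zero_iff F p] at h4
      exact absurd (Nat.le_of_dvd (Nat.succ_pos k) h4) (by omega)
    · exact hndvd (dvd_iff_isRoot.2 h4)

end Stepanov

/-! ### The auxiliary polynomial -/

namespace Stepanov

variable {F : Type*} [Field F]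

/-- The polynomial with coefficient vector `l` in the monomials
`X ^ a * X ^ (t * b) * (X - 1) ^ (t * c)`, where `a < A` and `b, c < B`. -/
noncomputable def auxPoly (t : ℕ) {A B : ℕ} (l : Fin A × Fin B × Fin B → F) : F[X] :=
  ∑ x, l x • (X ^ (x.1 : ℕ) * (X ^ (t * x.2.1) * (X - 1) ^ (t * x.2.2)))

theorem natDegree_auxPoly_le (t : ℕ) {A B : ℕ} (l : Fin A × Fin B × Fin B → F) :
    (auxPoly t l).natDegree ≤ A + 2 * t * B := by
  refine natDegree_sum_le_of_forall_le _ _ fun x _ ↦ (natDegree_smul_le _ _).trans ?_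
  have h1 : (X ^ (x.1 : ℕ) * (X ^ (t * x.2.1) * (X - 1) ^ (t * x.2.2)) : F[X]).natDegree ≤
      (x.1 : ℕ) + (t * x.2.1 + (t * x.2.2) * 1) := by
    refine natDegree_mul_le_of_le (natDegree_X_pow_le _) (natDegree_mul_le_of_le
      (natDegree_X_pow_le _) ?_)
    have : (X - 1 : F[X]).natDegree ≤ 1 := by compute_degree
    exact natDegree_pow_le_of_le _ this
  have h2 : t * (x.2.1 : ℕ) ≤ t * B := Nat.mul_le_mul_left _ x.2.1.2.le
  have h3 : t * (x.2.2 : ℕ) ≤ t * B := Nat.mul_le_mul_left _ x.2.2.2.le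
  have h4 := x.1.2
  have : 2 * t * B = t * B + t * B := by ring
  omega

/-- The products `X ^ a * X ^ (t * b) * (X - 1) ^ (t * c)` are linearly independent: if `c` is the
least index that occurs, its coefficient polynomial has at most `A * B ≤ t` terms and a zero of
order `t` at `1`. -/
theorem auxPoly_ne_zero (p : ℕ) [CharP F p] {t A B : ℕ} (hA : 0 < A) (hAB : A * B ≤ t) (htB : t * B ≤ p)
    {l : Fin A × Fin B × Fin B → F} (hl : l ≠ 0) : auxPoly t l ≠ 0 := by
  intro h0
  apply hl
  set f : Fin B → F[X] := fun c ↦ ∑ x : Fin A × Fin B, monomial ((x.1 : ℕ) + t * x.2) (l (x.1, x.2, c))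
    with hf
  have hsum : ∑ c : Fin B, (X - 1) ^ (t * (c : ℕ)) * f c = 0 := by
    rw [← h0, auxPoly]
    simp only [hf, Fintype.sum_prod_type, mul_sum]
    rw [sum_comm]
    refine sum_congr rfl fun a _ ↦ ?_
    rw [sum_comm]
    refine sum_congr rfl fun b _ ↦ sum_congr rfl fun c _ ↦ ?_
    rw [← C_mul_X_pow_eq_monomial, smul_eq_C_mul]
    ring
  have hAt : ∀ b : Fin B, A ≤ t := fun b ↦
    (Nat.le_mul_of_pos_right A (lt_of_le_of_lt (Nat.zero_le _) b.2)).trans hAB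
  have key : ∀ n : ℕ, ∀ c : Fin B, (c : ℕ) = n → f c = 0 := by
    intro n
    induction n using Nat.strong_induction_on with
    | _ n ih =>
      intro c hc
      have hdvd : (X - 1) ^ t ∣ f c := by
        have h1 : (X - 1) ^ (t * (c : ℕ)) * f c
            = - ∑ c' ∈ univ.erase c, (X - 1) ^ (t * (c' : ℕ)) * f c' := by
          rw [eq_neg_iff_add_eq_zero, ← hsum]
          exact add_sum_erase univ (fun c' : Fin B ↦ (X - 1) ^ (t * (c' : ℕ)) * f c') (mem_univ c)
        have h2 : (X - 1) ^ (t * (c : ℕ)) * (X - 1) ^ t ∣ (X - 1) ^ (t * (c : ℕ)) * f c := by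
          rw [h1, dvd_neg]
          refine dvd_sum fun c' hc' ↦ ?_
          rcases lt_or_gt_of_ne (ne_of_mem_erase hc') with hlt | hgt
          · rw [ih c' (by rw [← hc]; exact hlt) c' rfl, mul_zero]; exact dvd_zero _
          · rw [← pow_add]
            refine Dvd.dvd.mul_right (pow_dvd_pow _ ?_) _
            calc t * (c : ℕ) + t = t * ((c : ℕ) + 1) := by ring
              _ ≤ t * c' := Nat.mul_le_mul_left _ hgt
        exact (mul_dvd_mul_iff_left (pow_ne_zero _ (by simpa using X_sub_C_ne_zero (1 : F)))).1 h2
      refine eq_zero_of_X_sub_one_pow_dvd p t (f c) ?_ ?_ hdvd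
      · have hsub : (f c).support ⊆ univ.image fun x : Fin A × Fin B ↦ (x.1 : ℕ) + t * x.2 := by
          intro i hi
          by_contra hni
          refine mem_support_iff.1 hi ?_
          simp only [hf, finsetSum_coeff, coeff_monomial]
          exact sum_eq_zero fun x _ ↦ if_neg fun h ↦ hni (mem_image.2 ⟨x, mem_univ x, h⟩)
        exact (card_le_card hsub).trans (card_image_le.trans (by simpa using hAB))
      · refine lt_of_le_of_lt (natDegree_sum_le_of_forall_le (n := t * B - 1) _ _ fun x _ ↦ ?_) ?_
        · refine (natDegree_monomial_le _).trans ?_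
          have h1 := x.1.2
          have h2 := hAt x.2
          have h3 : t * (x.2 : ℕ) + t ≤ t * B := by
            calc t * (x.2 : ℕ) + t = t * ((x.2 : ℕ) + 1) := by ring
              _ ≤ t * B := Nat.mul_le_mul_left _ x.2.2
          omega
        · have := Nat.mul_pos (lt_of_lt_of_le hA (hAt c)) (lt_of_le_of_lt (Nat.zero_le _) c.2)
          omega
  funext ⟨a, b, c⟩
  have h1 : (f c).coeff ((a : ℕ) + t * b) = l (a, b, c) := by
    simp only [hf, finsetSum_coeff, coeff_monomial]
    rw [sum_eq_single (a, b)]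
    · simp
    · rintro ⟨a', b'⟩ _ hne
      rw [if_neg]
      intro heq
      apply hne
      have ha : (a : ℕ) < t := lt_of_lt_of_le a.2 (hAt b)
      have ha' : (a' : ℕ) < t := lt_of_lt_of_le a'.2 (hAt b)
      have e1 : (a' : ℕ) = a := by
        have := congrArg (· % t) heq
        simpa [Nat.add_mul_mod_self_left, Nat.mod_eq_of_lt, ha, ha'] using this
      have e2 : (b' : ℕ) = b := by
        simp only [e1] at heq
        exact Nat.eq_of_mul_eq_mul_left (by omega : 0 < t) (by omega)
      exact Prod.ext (Fin.ext e1) (Fin.ext e2)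
    · simp
  rw [← h1, key c c rfl, coeff_zero, Pi.zero_apply]

/-- Fewer linear conditions than unknowns: some nonzero coefficient vector makes the iterates
`(X (X - 1) d/dX)^n`, `n < A`, of the auxiliary polynomial vanish wherever `w ^ t = 1` and
`(w - 1) ^ t ∈ S`. -/
theorem exists_auxPoly_eval_eq_zero [DecidableEq F] {A B : ℕ} (t : ℕ) (S : Finset F) (hA : 0 < A)
    (hS : 2 * #S * A < B ^ 2) :
    ∃ l : Fin A × Fin B × Fin B → F, l ≠ 0 ∧
      ∀ w : F, w ^ t = 1 → (w - 1) ^ t ∈ S → ∀ n < A, eval w (eulerOp^[n] (auxPoly t l)) = 0 := by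
  let M : Matrix (Fin A × S × Fin (2 * A)) (Fin A × Fin B × Fin B) F := Matrix.of fun y x ↦
    (y.2.1 : F) ^ (x.2.2 : ℕ) *
      ((twistedOp (t * x.2.1) (t * x.2.2))^[(y.1 : ℕ)] (X ^ (x.1 : ℕ))).coeff (y.2.2 : ℕ)
  have hker : LinearMap.ker M.mulVecLin ≠ ⊥ := by
    apply LinearMap.ker_ne_bot_of_finrank_lt
    simp only [Module.finrank_fintype_fun_eq_card, Fintype.card_prod, Fintype.card_fin,
      Fintype.card_coe]
    calc A * (#S * (2 * A)) = A * (2 * #S * A) := by ring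
      _ < A * B ^ 2 := Nat.mul_lt_mul_of_pos_left hS hA
      _ = A * (B * B) := by ring
  obtain ⟨l, hl, hl0⟩ := Submodule.exists_mem_ne_zero_of_ne_bot hker
  refine ⟨l, hl0, fun w hw hwS n hn ↦ ?_⟩
  have hcoef : ∀ i : Fin (2 * A), ∑ x : Fin A × Fin B × Fin B, ((w - 1) ^ t) ^ (x.2.2 : ℕ) *
      ((twistedOp (t * x.2.1) (t * x.2.2))^[n] (X ^ (x.1 : ℕ) : F[X])).coeff (i : ℕ) * l x = 0 := by
    intro i
    have := congrFun (LinearMap.mem_ker.1 hl) (⟨n, hn⟩, ⟨_, hwS⟩, i)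
    simpa [M, Matrix.mulVec, dotProduct] using this
  have hit : ∀ (f : Fin A × Fin B × Fin B → F[X]), (eulerOp (F := F))^[n] (∑ x, l x • f x)
      = ∑ x, l x • (eulerOp (F := F))^[n] (f x) := by
    intro f
    have := map_sum ((eulerOp : F[X] →ₗ[F] F[X]) ^ n) (fun x ↦ l x • f x) univ
    simp only [map_smul, Module.End.coe_pow] at this
    exact this
  have hpoly : ∑ x : Fin A × Fin B × Fin B, (((w - 1) ^ t) ^ (x.2.2 : ℕ) * l x) •
      (twistedOp (t * x.2.1) (t * x.2.2))^[n] (X ^ (x.1 : ℕ) : F[X]) = 0 := by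
    ext i
    simp only [finsetSum_coeff, coeff_smul, smul_eq_mul, coeff_zero]
    by_cases hi : i < 2 * A
    · rw [← hcoef ⟨i, hi⟩]
      exact sum_congr rfl fun x _ ↦ by ring
    · refine sum_eq_zero fun x _ ↦ ?_
      rw [coeff_eq_zero_of_natDegree_lt, mul_zero]
      refine lt_of_le_of_lt (natDegree_twistedOp_iterate_le _ _ _ _) ?_
      rw [natDegree_X_pow]
      have := x.1.2
      omega
  have := congrArg (eval w) hpoly
  rw [auxPoly, hit, eval_finsetSum]
  rw [eval_finsetSum, eval_zero] at this
  rw [← this]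
  refine sum_congr rfl fun x _ ↦ ?_
  rw [eulerOp_iterate_mul]
  simp only [eval_smul, eval_mul, eval_pow, eval_X, eval_sub, eval_one, smul_eq_mul, pow_mul, hw,
    one_pow]
  ring

/-- Stepanov's method bounds the number of `w` with `w ^ t = 1` for which `(w - 1) ^ t` lies in a
small set. -/
theorem card_mul_le [DecidableEq F] (p : ℕ) [CharP F p] {t A B : ℕ} (hA : 0 < A) (hB : 0 < B)
    (hAB : A * B ≤ t) (htB : t * B ≤ p) (S : Finset F) (hS : 2 * #S * A < B ^ 2) (W : Finset F)
    (hW : ∀ w ∈ W, w ^ t = 1 ∧ w ≠ 1 ∧ (w - 1) ^ t ∈ S) : #W * A ≤ A + 2 * t * B := by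
  obtain ⟨l, hl0, hl⟩ := exists_auxPoly_eval_eq_zero t S hA hS
  have hAt : A ≤ t := (Nat.le_mul_of_pos_right A hB).trans hAB
  have htp : t ≤ p := (Nat.le_mul_of_pos_right t hB).trans htB
  have hdvd : ∏ w ∈ W, (X - C w) ^ A ∣ auxPoly t l := by
    refine Finset.prod_dvd_of_coprime (fun a _ b _ hab ↦ ?_) fun w hw ↦ ?_
    · exact (isCoprime_X_sub_C_of_isUnit_sub (sub_ne_zero.2 hab).isUnit).pow
    · obtain ⟨h1, h2, h3⟩ := hW w hw
      refine pow_dvd_of_eval_eulerOp_iterate p ?_ h2 A _ (hAt.trans htp) (hl w h1 h3)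
      rintro rfl
      rw [zero_pow (by omega)] at h1
      exact zero_ne_one h1
  have hdeg := natDegree_le_of_dvd hdvd (auxPoly_ne_zero p hA hAB htB hl0)
  rw [natDegree_prod_of_monic _ _ fun w _ ↦ (monic_X_sub_C w).pow A] at hdeg
  simp only [natDegree_pow, natDegree_X_sub_C, mul_one, sum_const, smul_eq_mul] at hdeg
  exact hdeg.trans (natDegree_auxPoly_le t l)

end Stepanov

/-! ### The additive energy of a subgroup -/

namespace Stepanov

/-- Stepanov's bound with optimised parameters: `B` is of size `(#S * t) ^ (1 / 3)` and `A = t / B`. -/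
theorem card_cube_le {F : Type*} [Field F] [DecidableEq F] (p : ℕ) [CharP F p] {t : ℕ}
    (ht : 7 ≤ t) (htp : 7 * t ^ 3 ≤ p ^ 2) (S : Finset F) (hS : 1 ≤ #S) (hSt : #S ^ 2 ≤ t)
    (W : Finset F) (hW : ∀ w ∈ W, w ^ t = 1 ∧ w ≠ 1 ∧ (w - 1) ^ t ∈ S) :
    #W ^ 3 ≤ 32000 * (#S ^ 2 * t ^ 2) := by
  set J := #S
  have hex : ∃ B, 2 * J * t < B ^ 3 := ⟨2 * J * t + 1, by
    calc 2 * J * t < 2 * J * t + 1 := Nat.lt_succ_self _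
      _ ≤ (2 * J * t + 1) ^ 3 := Nat.le_self_pow (by norm_num) _⟩
  classical
  obtain ⟨B, hB, hBmin⟩ : ∃ B, 2 * J * t < B ^ 3 ∧ ∀ m < B, ¬ 2 * J * t < m ^ 3 :=
    ⟨Nat.find hex, Nat.find_spec hex, fun m hm ↦ Nat.find_min hex hm⟩
  have hJt : 7 ≤ J * t := by nlinarith
  have hB2 : 2 ≤ B := by
    by_contra h
    have : B ^ 3 ≤ 1 := by
      have : B ≤ 1 := by omega
      exact (Nat.pow_le_pow_left this 3).trans (by norm_num)
    nlinarith
  have hB3 : B ^ 3 ≤ 16 * (J * t) := by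
    have h1 := not_lt.1 (hBmin (B - 1) (by omega))
    have h2 : B ≤ 2 * (B - 1) := by omega
    calc B ^ 3 ≤ (2 * (B - 1)) ^ 3 := Nat.pow_le_pow_left h2 3
      _ = 8 * (B - 1) ^ 3 := by ring
      _ ≤ 8 * (2 * J * t) := Nat.mul_le_mul_left _ h1
      _ = 16 * (J * t) := by ring
  have hB6 : B ^ 6 ≤ 256 * (J ^ 2 * t ^ 2) := by
    calc B ^ 6 = (B ^ 3) ^ 2 := by ring
      _ ≤ (16 * (J * t)) ^ 2 := Nat.pow_le_pow_left hB3 2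
      _ = 256 * (J ^ 2 * t ^ 2) := by ring
  have hB6' : B ^ 6 ≤ 256 * t ^ 3 := by
    calc B ^ 6 ≤ 256 * (J ^ 2 * t ^ 2) := hB6
      _ ≤ 256 * (t * t ^ 2) := by gcongr
      _ = 256 * t ^ 3 := by ring
  have ht3 : 7 ^ 3 ≤ t ^ 3 := Nat.pow_le_pow_left ht 3
  have hBt : B ≤ t := by
    refine le_of_pow_le_pow_left₀ (n := 6) (by norm_num) (Nat.zero_le _) (hB6'.trans ?_)
    calc 256 * t ^ 3 ≤ t ^ 3 * t ^ 3 := by gcongr; omega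
      _ = t ^ 6 := by ring
  have htB : t * B ≤ p := by
    refine le_of_pow_le_pow_left₀ (n := 6) (by norm_num) (Nat.zero_le _) ?_
    calc (t * B) ^ 6 = t ^ 6 * B ^ 6 := by ring
      _ ≤ t ^ 6 * (256 * t ^ 3) := by gcongr
      _ ≤ (7 * t ^ 3) ^ 3 := by ring_nf; gcongr; norm_num
      _ ≤ (p ^ 2) ^ 3 := Nat.pow_le_pow_left htp 3
      _ = p ^ 6 := by ring
  have hB0 : 0 < B := by omega
  set A := t / B with hAdef
  have hA : 0 < A := Nat.div_pos hBt hB0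
  have hAB : A * B ≤ t := Nat.div_mul_le_self t B
  have hAB' : t ≤ 2 * (A * B) := by
    have h1 := Nat.div_add_mod t B
    rw [mul_comm, ← hAdef] at h1
    have h2 := Nat.mod_lt t hB0
    have : B ≤ A * B := Nat.le_mul_of_pos_left B hA
    omega
  have hcond : 2 * J * A < B ^ 2 := by
    refine Nat.lt_of_mul_lt_mul_right (a := B) ?_
    calc 2 * J * A * B = 2 * J * (A * B) := by ring
      _ ≤ 2 * J * t := by gcongr
      _ < B ^ 3 := hB
      _ = B ^ 2 * B := by ring
  have hmain := card_mul_le p hA hB0 hAB htB S hcond W hW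
  have hW5 : #W ≤ 5 * B ^ 2 := by
    refine Nat.le_of_mul_le_mul_right (c := A) ?_ hA
    calc #W * A ≤ A + 2 * t * B := hmain
      _ ≤ A + 2 * (2 * (A * B)) * B := by gcongr
      _ = A * 1 + 4 * B ^ 2 * A := by ring
      _ ≤ A * B ^ 2 + 4 * B ^ 2 * A := by gcongr; exact Nat.one_le_pow _ _ hB0
      _ = 5 * B ^ 2 * A := by ring
  calc #W ^ 3 ≤ (5 * B ^ 2) ^ 3 := Nat.pow_le_pow_left hW5 3
    _ = 125 * B ^ 6 := by ring
    _ ≤ 125 * (256 * (J ^ 2 * t ^ 2)) := by gcongr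
    _ = 32000 * (J ^ 2 * t ^ 2) := by ring

end Stepanov

/-- Summation by levels: if `#{i | k ≤ f i}` is at most `Q / k ^ 3` for all `k ≥ L`, then the squares
of the values `f i ≥ L` sum to `O(Q / L)`. -/
theorem sum_sq_le_of_card_level_le {ι : Type*} (s : Finset ι) (f : ι → ℕ) {L : ℕ} (hL : 1 ≤ L)
    {Q : ℝ} (hQ : ∀ k, L ≤ k → (k : ℝ) ^ 3 * #{i ∈ s | k ≤ f i} ≤ Q) :
    ∑ i ∈ s with L ≤ f i, (f i : ℝ) ^ 2 ≤ 3 * Q / L := by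
  have hL0 : (0 : ℝ) < L := by exact_mod_cast hL
  obtain ⟨N, hN, hLN⟩ : ∃ N, (∀ i ∈ s, f i ≤ N) ∧ L ≤ N :=
    ⟨s.sup f + L, fun i hi ↦ (le_sup hi).trans (Nat.le_add_right _ _), Nat.le_add_left _ _⟩
  have hsq : ∀ n, L ≤ n → (n : ℝ) ^ 2 ≤ (L : ℝ) ^ 2 + ∑ k ∈ Ioc L n, 2 * (k : ℝ) := by
    intro n hn
    induction n, hn using Nat.le_induction with
    | base => simp
    | succ n hn ih =>
      rw [Finset.sum_Ioc_succ_top (by omega)]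
      push_cast
      nlinarith
  have hcard : ∀ k, L ≤ k → (#{i ∈ s | k ≤ f i} : ℝ) ≤ Q / (k : ℝ) ^ 3 := by
    intro k hk
    have hk0 : (0 : ℝ) < k := by exact_mod_cast lt_of_lt_of_le hL hk
    rw [le_div_iff₀ (by positivity), mul_comm]
    exact hQ k hk
  have hQ0 : 0 ≤ Q := le_trans (by positivity) (hQ L le_rfl)
  calc ∑ i ∈ s with L ≤ f i, (f i : ℝ) ^ 2
      ≤ ∑ i ∈ s with L ≤ f i, ((L : ℝ) ^ 2 + ∑ k ∈ Ioc L N, if k ≤ f i then 2 * (k : ℝ) else 0) := by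
        refine sum_le_sum fun i hi ↦ ?_
        obtain ⟨his, hi⟩ := mem_filter.1 hi
        refine (hsq _ hi).trans (add_le_add le_rfl (le_of_eq ?_))
        rw [← sum_filter]
        refine sum_congr ?_ fun _ _ ↦ rfl
        ext k
        have := hN i his
        simp only [mem_Ioc, mem_filter]
        omega
    _ = (L : ℝ) ^ 2 * #{i ∈ s | L ≤ f i} +
        ∑ k ∈ Ioc L N, 2 * (k : ℝ) * #{i ∈ s | k ≤ f i} := by
        rw [sum_add_distrib, sum_const, sum_comm, nsmul_eq_mul, mul_comm]
        congr 1
        refine sum_congr rfl fun k hk ↦ ?_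
        rw [← sum_filter, filter_filter, sum_const, nsmul_eq_mul, mul_comm]
        congr 3
        have := (mem_Ioc.1 hk).1
        ext i
        simp only [mem_filter]
        constructor
        · rintro ⟨h1, h2, h3⟩; exact ⟨h1, h3⟩
        · rintro ⟨h1, h2⟩; exact ⟨h1, by omega, h2⟩
    _ ≤ (L : ℝ) ^ 2 * (Q / (L : ℝ) ^ 3) + ∑ k ∈ Ioc L N, 2 * Q * ((k : ℝ) ^ 2)⁻¹ := by
        refine add_le_add (by gcongr; exact hcard L le_rfl) (sum_le_sum fun k hk ↦ ?_)
        have hk := (mem_Ioc.1 hk).1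
        have hk0 : (0 : ℝ) < k := by exact_mod_cast lt_of_lt_of_le hL hk.le
        calc 2 * (k : ℝ) * #{i ∈ s | k ≤ f i} ≤ 2 * (k : ℝ) * (Q / (k : ℝ) ^ 3) := by
              gcongr; exact hcard k hk.le
          _ = 2 * Q * ((k : ℝ) ^ 2)⁻¹ := by field_simp
    _ ≤ Q / L + 2 * Q * (L : ℝ)⁻¹ := by
        rw [← mul_sum]
        refine add_le_add (le_of_eq (by field_simp)) ?_
        refine mul_le_mul_of_nonneg_left ?_ (by positivity)
        refine (sum_Ioc_inv_sq_le_sub (by omega) hLN).trans ?_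
        have : (0 : ℝ) ≤ (N : ℝ)⁻¹ := by positivity
        linarith
    _ = 3 * Q / L := by field_simp; ring

section Energy

variable {p : ℕ} [Fact p.Prime] (G : Subgroup (ZMod p)ˣ)

open Classical in
/-- The elements of a subgroup of the unit group, as a set of residues. -/
noncomputable def residues : Finset (ZMod p) := {x | ∃ v ∈ G, (v : ZMod p) = x}

/-- The number of representations of `c` as a difference of two elements of `G`. -/
noncomputable def diffCount (c : ZMod p) : ℕ :=
  #{x ∈ residues G ×ˢ residues G | x.1 - x.2 = c}

variable {G}

theorem mem_residues {x : ZMod p} : x ∈ residues G ↔ ∃ v ∈ G, (v : ZMod p) = x := by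
  simp [residues]

theorem card_residues : #(residues G) = Nat.card G := by
  classical
  have : residues G = Finset.univ.image fun v : G ↦ ((v : (ZMod p)ˣ) : ZMod p) := by
    ext x; simp [mem_residues]
  rw [this, card_image_of_injective, card_univ, Nat.card_eq_fintype_card]
  exact fun v w h ↦ Subtype.ext (Units.ext h)

theorem residues_pow_card {x : ZMod p} (hx : x ∈ residues G) : x ^ Nat.card G = 1 := by
  obtain ⟨v, hv, rfl⟩ := mem_residues.1 hx
  have : (⟨v, hv⟩ : G) ^ Nat.card G = 1 := pow_card_eq_one'
  have h2 : v ^ Nat.card G = 1 := by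
    simpa only [SubgroupClass.coe_pow, OneMemClass.coe_one] using congrArg Subtype.val this
  rw [← Units.val_pow_eq_pow_val, h2, Units.val_one]

theorem ne_zero_of_mem_residues {x : ZMod p} (hx : x ∈ residues G) : x ≠ 0 := by
  obtain ⟨v, hv, rfl⟩ := mem_residues.1 hx
  exact v.ne_zero

theorem diffCount_le_card (c : ZMod p) : diffCount G c ≤ Nat.card G := by
  rw [← card_residues, diffCount]
  refine card_le_card_of_injOn Prod.fst (fun x hx ↦ ?_) fun x hx y hy h ↦ ?_
  · exact (mem_product.1 (mem_filter.1 hx).1).1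
  · have h1 := (mem_filter.1 hx).2
    have h2 := (mem_filter.1 hy).2
    exact Prod.ext h (by linear_combination h - h1 + h2)

theorem sum_diffCount : ∑ c, diffCount G c = Nat.card G ^ 2 := by
  rw [← card_residues, sq, ← card_product]
  exact (card_eq_sum_card_fiberwise fun x _ ↦ mem_coe.2 (mem_univ (x.1 - x.2))).symm

/-- The quotients `x / y` of the representations `x - y = c` are elements `w` of `G` for which
`w - 1` lies in the coset of `c`; distinct representations have distinct quotients. -/
theorem diffCount_le_card_filter {c : ZMod p} (hc : c ≠ 0) :
    diffCount G c ≤ #{w : ZMod p | w ^ Nat.card G = 1 ∧ w ≠ 1 ∧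
      (w - 1) ^ Nat.card G = c ^ Nat.card G} := by
  refine card_le_card_of_injOn (fun x ↦ x.1 / x.2) (fun x hx ↦ ?_) fun x hx y hy h ↦ ?_
  · obtain ⟨hx1, hx2⟩ := mem_filter.1 hx
    obtain ⟨h1, h2⟩ := mem_product.1 hx1
    have h0 := ne_zero_of_mem_residues h2
    have e : x.1 / x.2 - 1 = c / x.2 := by rw [← hx2]; field_simp
    simp only [coe_filter, mem_univ, true_and, Set.mem_ofPred_eq]
    refine ⟨?_, ?_, ?_⟩
    · rw [div_pow, residues_pow_card h1, residues_pow_card h2, div_one]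
    · rw [← sub_ne_zero, e]
      exact div_ne_zero hc h0
    · rw [e, div_pow, residues_pow_card h2, div_one]
  · obtain ⟨hx1, hx2⟩ := mem_filter.1 hx
    obtain ⟨hy1, hy2⟩ := mem_filter.1 hy
    have h0 := ne_zero_of_mem_residues (mem_product.1 hx1).2
    have h0' := ne_zero_of_mem_residues (mem_product.1 hy1).2
    simp only at h
    have e : x.1 / x.2 - 1 = c / x.2 := by rw [← hx2]; field_simp
    have e' : y.1 / y.2 - 1 = c / y.2 := by rw [← hy2]; field_simp
    rw [h, e'] at e
    have h2 : x.2 = y.2 := by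
      rw [div_eq_div_iff h0' h0] at e
      exact mul_left_cancel₀ hc e
    exact Prod.ext (by linear_combination hx2 - hy2 + h2) h2

/-- At most `O(t ^ 3 / k ^ 3)` nonzero residues have `k` or more representations: Stepanov's method
applies to the classes modulo `G` of these residues, as long as there are at most `√t` of them. -/
theorem cube_mul_card_diffCount_le (htp : 7 * Nat.card G ^ 3 ≤ p ^ 2) {k : ℕ}
    (hk : 1600 * Nat.card G < k ^ 2) :
    k ^ 3 * #{c : ZMod p | c ≠ 0 ∧ k ≤ diffCount G c} ≤ 32000 * Nat.card G ^ 3 := by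
  set t := Nat.card G with ht
  set Cs : Finset (ZMod p) := {c : ZMod p | c ≠ 0 ∧ k ≤ diffCount G c} with hCs
  rcases Cs.eq_empty_or_nonempty with hemp | ⟨c₀, hc₀⟩
  · rw [hemp]; simp
  have hkt : k ≤ t := (mem_filter.1 hc₀).2.2.trans (diffCount_le_card c₀)
  have ht1600 : 1600 < t := by
    have : 1600 * t < t * t := by nlinarith
    exact Nat.lt_of_mul_lt_mul_right this
  set S := Cs.image (· ^ t) with hS
  have hCard : #Cs ≤ t * #S := by
    refine card_le_mul_card_image Cs t fun γ _ ↦ ?_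
    refine le_trans (card_le_card (t := (nthRoots t γ).toFinset) fun c hc ↦ ?_)
      ((Multiset.toFinset_card_le _).trans (card_nthRoots t γ))
    rw [Multiset.mem_toFinset, mem_nthRoots (by omega)]
    exact (mem_filter.1 hc).2
  have hstep : ∀ S' ⊆ S, 1 ≤ #S' → #S' ^ 2 ≤ t → k ^ 3 * #S' ≤ 32000 * t ^ 2 := by
    intro S' hS' h1 h2
    set W : Finset (ZMod p) := {w : ZMod p | w ^ t = 1 ∧ w ≠ 1 ∧ (w - 1) ^ t ∈ S'} with hW
    have hWcard : #S' * k ≤ #W := by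
      rw [card_eq_sum_card_fiberwise (f := fun w ↦ (w - 1) ^ t) (s := W) (t := S')
        fun w hw ↦ (mem_filter.1 hw).2.2.2]
      rw [← smul_eq_mul]
      refine card_nsmul_le_sum _ _ _ fun γ hγ ↦ ?_
      obtain ⟨c, hc, rfl⟩ := mem_image.1 (hS' hγ)
      obtain ⟨hc0, hck⟩ := (mem_filter.1 hc).2
      refine hck.trans ((diffCount_le_card_filter hc0).trans (card_le_card fun w hw ↦ ?_))
      obtain ⟨_, hw1, hw2, hw3⟩ := mem_filter.1 hw
      exact mem_filter.2 ⟨mem_filter.2 ⟨mem_univ _, hw1, hw2, by rw [hw3]; exact hγ⟩, hw3⟩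
    have h3 := Stepanov.card_cube_le p (by omega) htp S' h1 h2 W fun w hw ↦ (mem_filter.1 hw).2
    have h4 : #S' ^ 2 * (k ^ 3 * #S') ≤ #S' ^ 2 * (32000 * t ^ 2) := by
      calc #S' ^ 2 * (k ^ 3 * #S') = (#S' * k) ^ 3 := by ring
        _ ≤ #W ^ 3 := Nat.pow_le_pow_left hWcard 3
        _ ≤ 32000 * (#S' ^ 2 * t ^ 2) := h3
        _ = #S' ^ 2 * (32000 * t ^ 2) := by ring
    exact Nat.le_of_mul_le_mul_left h4 (by positivity)
  have hS1 : 1 ≤ #S := card_pos.2 ⟨_, mem_image_of_mem _ hc₀⟩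
  by_cases hSt : #S ^ 2 ≤ t
  · calc k ^ 3 * #Cs ≤ k ^ 3 * (t * #S) := by gcongr
      _ = t * (k ^ 3 * #S) := by ring
      _ ≤ t * (32000 * t ^ 2) := Nat.mul_le_mul_left _ (hstep S subset_rfl hS1 hSt)
      _ = 32000 * t ^ 3 := by ring
  -- Otherwise `√t` of the classes already contradict the lower bound on `k`.
  · exfalso
    set J := Nat.sqrt t with hJ
    have hJ1 : J ^ 2 ≤ t := Nat.sqrt_le' t
    have hJ2 : t < (J + 1) ^ 2 := Nat.lt_succ_sqrt' t
    have hJ0 : 1 ≤ J := by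
      by_contra h
      have : J = 0 := by omega
      rw [this] at hJ2; omega
    have hJS : J ≤ #S := by
      by_contra h
      have : #S ^ 2 ≤ J ^ 2 := Nat.pow_le_pow_left (by omega) 2
      omega
    obtain ⟨S', hS', hS'J⟩ := exists_subset_card_eq hJS
    have h1 := hstep S' hS' (by omega) (by rw [hS'J]; exact hJ1)
    rw [hS'J] at h1
    have h2 : t ≤ 4 * J ^ 2 := by nlinarith
    have h3 : (k ^ 2) ^ 3 * t ≤ (1600 * t) ^ 3 * t := by
      calc (k ^ 2) ^ 3 * t ≤ (k ^ 2) ^ 3 * (4 * J ^ 2) := by gcongr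
        _ = 4 * (k ^ 3 * J) ^ 2 := by ring
        _ ≤ 4 * (32000 * t ^ 2) ^ 2 := by gcongr
        _ = (1600 * t) ^ 3 * t := by ring
    have h4 := Nat.le_of_mul_le_mul_right h3 (by omega)
    exact absurd (Nat.pow_lt_pow_left hk (by norm_num : 3 ≠ 0)) (by omega)

/-- The additive energy of a subgroup of order `t ≪ p ^ (2 / 3)` is `O(t ^ (5 / 2))`. -/
theorem sum_diffCount_sq_le (htp : 7 * Nat.card G ^ 3 ≤ p ^ 2) :
    ∑ c, (diffCount G c : ℝ) ^ 2 ≤ 2500 * ((Nat.card G : ℝ) ^ 2 * √(Nat.card G)) := by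
  set t := Nat.card G with ht
  have ht1 : 1 ≤ t := Nat.card_pos
  have hs1 : 1 ≤ √(t : ℝ) := Real.one_le_sqrt.2 (by exact_mod_cast ht1)
  have hss : √(t : ℝ) ^ 2 = t := Real.sq_sqrt (Nat.cast_nonneg t)
  set L := Nat.sqrt (1600 * t) + 1 with hL
  have hL1 : 1600 * t < L ^ 2 := Nat.lt_succ_sqrt' _
  have hLs : 40 * √(t : ℝ) ≤ L := by
    refine le_of_pow_le_pow_left₀ (n := 2) (by norm_num) (Nat.cast_nonneg _) ?_
    rw [mul_pow, hss]
    have : ((1600 * t : ℕ) : ℝ) ≤ ((L ^ 2 : ℕ) : ℝ) := by exact_mod_cast hL1.le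
    push_cast at this
    linarith
  have hLs' : (L : ℝ) - 1 ≤ 40 * √(t : ℝ) := by
    refine le_of_pow_le_pow_left₀ (n := 2) (by norm_num) (by positivity) ?_
    rw [mul_pow, hss]
    have : (((Nat.sqrt (1600 * t)) ^ 2 : ℕ) : ℝ) ≤ ((1600 * t : ℕ) : ℝ) := by
      exact_mod_cast Nat.sqrt_le' _
    push_cast at this
    have e : (L : ℝ) - 1 = (Nat.sqrt (1600 * t) : ℝ) := by rw [hL]; push_cast; ring
    rw [e]
    linarith
  set s : Finset (ZMod p) := {c : ZMod p | c ≠ 0} with hs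
  have hbig : ∑ c ∈ s with L ≤ diffCount G c, (diffCount G c : ℝ) ^ 2
      ≤ 3 * (32000 * (t : ℝ) ^ 3) / L := by
    refine sum_sq_le_of_card_level_le s _ (by omega) fun k hk ↦ ?_
    have h1 : 1600 * t < k ^ 2 := hL1.trans_le (Nat.pow_le_pow_left hk 2)
    have h2 := cube_mul_card_diffCount_le htp h1
    rw [hs, filter_filter]
    exact_mod_cast h2
  have hbig' : 3 * (32000 * (t : ℝ) ^ 3) / L ≤ 2400 * ((t : ℝ) ^ 2 * √t) := by
    rw [div_le_iff₀ (by positivity)]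
    calc 3 * (32000 * (t : ℝ) ^ 3) = 2400 * ((t : ℝ) ^ 2 * √t) * (40 * √t) := by
          linear_combination (-96000 * (t : ℝ) ^ 2) * hss
      _ ≤ 2400 * ((t : ℝ) ^ 2 * √t) * L := by gcongr
  have hsmall : ∑ c ∈ s with ¬ L ≤ diffCount G c, (diffCount G c : ℝ) ^ 2
      ≤ 40 * ((t : ℝ) ^ 2 * √t) := by
    calc ∑ c ∈ s with ¬ L ≤ diffCount G c, (diffCount G c : ℝ) ^ 2
        ≤ ∑ c ∈ s with ¬ L ≤ diffCount G c, 40 * √(t : ℝ) * diffCount G c := by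
          refine sum_le_sum fun c hc ↦ ?_
          have h1 : (diffCount G c : ℝ) + 1 ≤ L := by
            exact_mod_cast not_le.1 (mem_filter.1 hc).2
          rw [sq]
          gcongr
          linarith
      _ ≤ ∑ c, 40 * √(t : ℝ) * diffCount G c :=
          sum_le_univ_sum_of_nonneg fun c ↦ by positivity
      _ = 40 * ((t : ℝ) ^ 2 * √t) := by
          rw [← mul_sum, ← Nat.cast_sum, sum_diffCount]; push_cast; ring
  have hzero : (diffCount G 0 : ℝ) ^ 2 ≤ (t : ℝ) ^ 2 * √t := by
    have : (diffCount G 0 : ℝ) ≤ t := by exact_mod_cast diffCount_le_card (G := G) 0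
    calc (diffCount G 0 : ℝ) ^ 2 ≤ (t : ℝ) ^ 2 * 1 := by rw [mul_one]; gcongr
      _ ≤ _ := by gcongr
  have hsplit : ∑ c, (diffCount G c : ℝ) ^ 2 =
      (diffCount G 0 : ℝ) ^ 2 + ∑ c ∈ s, (diffCount G c : ℝ) ^ 2 := by
    rw [← add_sum_erase univ _ (mem_univ (0 : ZMod p))]
    congr 2
    ext c; simp [hs]
  rw [hsplit, ← sum_filter_add_sum_filter_not s (fun c ↦ L ≤ diffCount G c)]
  have : 0 ≤ (t : ℝ) ^ 2 * √t := by positivity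
  linarith

end Energy

/-! ### Fractions of small height in a subgroup -/

/-- The divisor bound `τ(n) = O(n ^ ε)`. -/
theorem exists_card_divisors_le_rpow {ε : ℝ} (hε : 0 < ε) :
    ∃ C : ℝ, 1 ≤ C ∧ ∀ n : ℕ, n ≠ 0 → (#n.divisors : ℝ) ≤ C * (n : ℝ) ^ ε := by
  have hlog : 0 < Real.log 2 := Real.log_pos (by norm_num)
  set K : ℝ := 1 + 1 / (ε * Real.log 2) with hK
  have hK1 : 1 ≤ K := by rw [hK]; have : 0 ≤ 1 / (ε * Real.log 2) := by positivity
                         linarith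
  set P := ⌈(2 : ℝ) ^ (1 / ε)⌉₊ with hP
  -- Primes `q ≥ 2 ^ (1 / ε)` contribute at most `1` to `τ(n) / n ^ ε`, the others at most `K`.
  have hprime : ∀ q a : ℕ, 2 ≤ q →
      ((a : ℝ) + 1) ≤ (if q < P then K else 1) * ((q : ℝ) ^ a) ^ ε := by
    intro q a hq
    have hq2 : (2 : ℝ) ≤ q := by exact_mod_cast hq
    split_ifs with h
    · have h1 : ((2 : ℝ) ^ a) ^ ε ≤ ((q : ℝ) ^ a) ^ ε := by gcongr
      have h2 : 1 + a * (ε * Real.log 2) ≤ ((2 : ℝ) ^ a) ^ ε := by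
        rw [← Real.rpow_natCast, ← Real.rpow_mul (by norm_num), Real.rpow_def_of_pos (by norm_num)]
        have := Real.add_one_le_exp (Real.log 2 * (a * ε))
        linarith
      calc (a : ℝ) + 1 ≤ K * (1 + a * (ε * Real.log 2)) := by
            have e : K * (1 + a * (ε * Real.log 2)) =
                (a + 1) + (1 / (ε * Real.log 2) + a * (ε * Real.log 2)) := by
              rw [hK]; field_simp; ring
            rw [e]
            have : 0 ≤ 1 / (ε * Real.log 2) + a * (ε * Real.log 2) := by positivity
            linarith
        _ ≤ K * ((q : ℝ) ^ a) ^ ε := by gcongr; exact h2.trans h1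
    · have h1 : (2 : ℝ) ^ (1 / ε) ≤ q := (Nat.le_ceil _).trans (by exact_mod_cast not_lt.1 h)
      have h2 : (2 : ℝ) ≤ (q : ℝ) ^ ε := by
        calc (2 : ℝ) = ((2 : ℝ) ^ (1 / ε)) ^ ε := by
              rw [← Real.rpow_mul (by norm_num), one_div_mul_cancel hε.ne', Real.rpow_one]
          _ ≤ _ := by gcongr
      have h3 : ((q : ℝ) ^ a) ^ ε = ((q : ℝ) ^ ε) ^ a := by
        rw [← Real.rpow_natCast, ← Real.rpow_natCast, ← Real.rpow_mul (by positivity),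
          ← Real.rpow_mul (by positivity), mul_comm]
      rw [one_mul, h3]
      calc (a : ℝ) + 1 ≤ (2 : ℝ) ^ a := by exact_mod_cast Nat.lt_two_pow_self
        _ ≤ _ := by gcongr
  refine ⟨K ^ P, one_le_pow₀ hK1, fun n hn ↦ ?_⟩
  have hn' : (n : ℝ) = ∏ q ∈ n.primeFactors, (q : ℝ) ^ n.factorization q := by
    conv_lhs => rw [← Nat.prod_factorization_pow_eq_self hn]
    rw [Finsupp.prod, Nat.support_factorization]; push_cast; rfl
  rw [Nat.card_divisors hn, hn', ← Real.finsetProd_rpow _ _ fun q _ ↦ by positivity]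
  push_cast
  calc ∏ q ∈ n.primeFactors, ((n.factorization q : ℝ) + 1)
      ≤ ∏ q ∈ n.primeFactors, (if q < P then K else 1) * ((q : ℝ) ^ n.factorization q) ^ ε :=
        prod_le_prod (fun q _ ↦ by positivity)
          fun q hq ↦ hprime q _ (Nat.prime_of_mem_primeFactors hq).two_le
    _ = (∏ q ∈ n.primeFactors, (if q < P then K else 1)) *
          ∏ q ∈ n.primeFactors, ((q : ℝ) ^ n.factorization q) ^ ε := prod_mul_distrib
    _ ≤ _ := by
        refine mul_le_mul_of_nonneg_right ?_ (prod_nonneg fun q _ ↦ by positivity)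
        rw [← prod_filter, prod_const]
        refine pow_le_pow_right₀ hK1 ((card_le_card (t := range P) fun q hq ↦ ?_).trans
          (card_range P).le)
        exact mem_range.2 (mem_filter.1 hq).2

/-- Each pair `(a, b)` carries a label that is one of at most `T` labels attached to `a` and one of
at most `T` labels attached to `b`. If, once the label is fixed, a product has at most `T'`
preimages, then the number of products is at least `#A * #B / (T ^ 2 * T')`. -/
theorem card_mul_card_le_of_label {α β Λ M : Type*} [DecidableEq Λ] [DecidableEq M]
    (A : Finset α) (B : Finset β) (lab : α → β → Λ) (LA : α → Finset Λ) (LB : β → Finset Λ)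
    (mulMap : α → β → M) (P : Finset M) {T T' : ℕ} (hLA : ∀ a ∈ A, #(LA a) ≤ T)
    (hLB : ∀ b ∈ B, #(LB b) ≤ T) (hlabA : ∀ a ∈ A, ∀ b ∈ B, lab a b ∈ LA a)
    (hlabB : ∀ a ∈ A, ∀ b ∈ B, lab a b ∈ LB b) (hmul : ∀ a ∈ A, ∀ b ∈ B, mulMap a b ∈ P)
    (hmult : ∀ l, ∀ m ∈ P, #{x ∈ A ×ˢ B | lab x.1 x.2 = l ∧ mulMap x.1 x.2 = m} ≤ T') :
    #A * #B ≤ T ^ 2 * T' * #P := by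
  set L := A.biUnion LA with hL
  set n : Λ → ℕ := fun l ↦ #{x ∈ A ×ˢ B | lab x.1 x.2 = l}
  have hsum : ∑ l ∈ L, n l = #A * #B := by
    rw [← card_product]
    refine (card_eq_sum_card_fiberwise fun x hx ↦ ?_).symm
    obtain ⟨ha, hb⟩ := mem_product.1 hx
    exact mem_biUnion.2 ⟨x.1, ha, hlabA _ ha _ hb⟩
  have hn1 : ∀ l, n l ≤ T' * #P := by
    intro l
    have : n l = ∑ m ∈ P, #{x ∈ A ×ˢ B | lab x.1 x.2 = l ∧ mulMap x.1 x.2 = m} := by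
      change #{x ∈ A ×ˢ B | lab x.1 x.2 = l} = _
      rw [card_eq_sum_card_fiberwise (f := fun x : α × β ↦ mulMap x.1 x.2) (t := P)]
      · simp_rw [filter_filter]
      · intro x hx
        obtain ⟨ha, hb⟩ := mem_product.1 (mem_filter.1 hx).1
        exact hmul _ ha _ hb
    rw [this, mul_comm, ← smul_eq_mul]
    exact sum_le_card_nsmul _ _ _ (hmult l)
  have hn2 : ∀ l, n l ≤ #{a ∈ A | l ∈ LA a} * #{b ∈ B | l ∈ LB b} := by
    intro l
    rw [← card_product]
    refine card_le_card fun x hx ↦ ?_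
    obtain ⟨hx', rfl⟩ := mem_filter.1 hx
    obtain ⟨ha, hb⟩ := mem_product.1 hx'
    exact mem_product.2 ⟨mem_filter.2 ⟨ha, hlabA _ ha _ hb⟩, mem_filter.2 ⟨hb, hlabB _ ha _ hb⟩⟩
  have hA : ∑ l ∈ L, #{a ∈ A | l ∈ LA a} ≤ T * #A := by
    have h1 := sum_card_bipartiteAbove_eq_sum_card_bipartiteBelow (s := A) (t := L)
      (fun a l ↦ l ∈ LA a)
    simp only [bipartiteAbove, bipartiteBelow] at h1
    rw [← h1, mul_comm, ← smul_eq_mul]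
    exact sum_le_card_nsmul _ _ _ fun a ha ↦
      (card_le_card fun l hl ↦ (mem_filter.1 hl).2).trans (hLA a ha)
  have hB : ∑ l ∈ L, #{b ∈ B | l ∈ LB b} ≤ T * #B := by
    have h1 := sum_card_bipartiteAbove_eq_sum_card_bipartiteBelow (s := B) (t := L)
      (fun a l ↦ l ∈ LB a)
    simp only [bipartiteAbove, bipartiteBelow] at h1
    rw [← h1, mul_comm, ← smul_eq_mul]
    exact sum_le_card_nsmul _ _ _ fun a ha ↦
      (card_le_card fun l hl ↦ (mem_filter.1 hl).2).trans (hLB a ha)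
  have hCS : (∑ l ∈ L, n l) ^ 2 ≤
      (∑ l ∈ L, T' * #P * #{a ∈ A | l ∈ LA a}) * ∑ l ∈ L, #{b ∈ B | l ∈ LB b} := by
    refine sum_sq_le_sum_mul_sum_of_sq_le_mul _ (fun _ _ ↦ Nat.zero_le _)
      (fun _ _ ↦ Nat.zero_le _) fun l _ ↦ ?_
    rw [sq, mul_assoc]
    exact Nat.mul_le_mul (hn1 l) (hn2 l)
  rw [hsum, ← mul_sum] at hCS
  rcases Nat.eq_zero_or_pos (#A * #B) with h0 | h0
  · rw [h0]; exact Nat.zero_le _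
  refine Nat.le_of_mul_le_mul_right (c := #A * #B) ?_ h0
  calc #A * #B * (#A * #B) = (#A * #B) ^ 2 := by ring
    _ ≤ _ := hCS
    _ ≤ T' * #P * (T * #A) * (T * #B) := by gcongr
    _ = T ^ 2 * T' * #P * (#A * #B) := by ring

section Fractions

variable {p : ℕ} [Fact p.Prime] (Γ : Subgroup (ZMod p)ˣ)

open Classical in
/-- The reduced fractions `y / x` with numerator and denominator in `[1, n]` whose residue modulo
`p` lies in the subgroup `Γ`, as pairs `(x, y)`. -/
noncomputable def fractionsIn (n : ℕ) : Finset (ℕ × ℕ) :=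
  {x ∈ Icc 1 n ×ˢ Icc 1 n | x.1.Coprime x.2 ∧ ∃ g ∈ Γ, (x.2 : ZMod p) = g * (x.1 : ZMod p)}

variable {Γ}

theorem mem_fractionsIn {n : ℕ} {x : ℕ × ℕ} : x ∈ fractionsIn Γ n ↔
    ((1 ≤ x.1 ∧ x.1 ≤ n) ∧ (1 ≤ x.2 ∧ x.2 ≤ n)) ∧ x.1.Coprime x.2 ∧
      ∃ g ∈ Γ, (x.2 : ZMod p) = g * (x.1 : ZMod p) := by
  simp [fractionsIn]

theorem cast_ne_zero_of_mem_fractionsIn {n : ℕ} {x : ℕ × ℕ} (hx : x ∈ fractionsIn Γ n) :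
    (x.1 : ZMod p) ≠ 0 ∧ (x.2 : ZMod p) ≠ 0 := by
  obtain ⟨_, hcop, g, -, hg⟩ := mem_fractionsIn.1 hx
  have key : (x.1 : ZMod p) ≠ 0 := by
    intro h
    rw [h, mul_zero] at hg
    rw [ZMod.natCast_eq_zero_iff] at h hg
    have := Nat.dvd_gcd h hg
    rw [hcop] at this
    exact (Fact.out : p.Prime).one_lt.ne' (Nat.dvd_one.1 this)
  exact ⟨key, by rw [hg]; exact mul_ne_zero g.ne_zero key⟩

/-- The reduced form of the product of two fractions. -/
def reducedMul (a b : ℕ × ℕ) : ℕ × ℕ :=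
  (a.1 / a.1.gcd b.2 * (b.1 / a.2.gcd b.1), a.2 / a.2.gcd b.1 * (b.2 / a.1.gcd b.2))

theorem reducedMul_mem {m n : ℕ} {a b : ℕ × ℕ} (ha : a ∈ fractionsIn Γ m)
    (hb : b ∈ fractionsIn Γ n) : reducedMul a b ∈ fractionsIn Γ (m * n) := by
  have ha0 := cast_ne_zero_of_mem_fractionsIn ha
  have hb0 := cast_ne_zero_of_mem_fractionsIn hb
  obtain ⟨⟨⟨h1, h2⟩, h3, h4⟩, hac, g, hg, hga⟩ := mem_fractionsIn.1 ha
  obtain ⟨⟨⟨k1, k2⟩, k3, k4⟩, hbc, g', hg', hgb⟩ := mem_fractionsIn.1 hb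
  obtain ⟨x₁, y₁⟩ := a
  obtain ⟨x₂, y₂⟩ := b
  simp only [reducedMul] at *
  set d := y₁.gcd x₂ with hd
  set e := x₁.gcd y₂ with he
  have hd0 : 0 < d := Nat.gcd_pos_of_pos_left _ h3
  have he0 : 0 < e := Nat.gcd_pos_of_pos_left _ h1
  obtain ⟨u₁, hu₁⟩ : e ∣ x₁ := Nat.gcd_dvd_left _ _
  obtain ⟨v₂, hv₂⟩ : e ∣ y₂ := Nat.gcd_dvd_right _ _
  obtain ⟨v₁, hv₁⟩ : d ∣ y₁ := Nat.gcd_dvd_left _ _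
  obtain ⟨u₂, hu₂⟩ : d ∣ x₂ := Nat.gcd_dvd_right _ _
  have c1 : u₁.Coprime v₂ := by
    have := Nat.coprime_div_gcd_div_gcd (m := x₁) (n := y₂) he0
    rw [← he] at this
    rwa [hu₁, hv₂, Nat.mul_div_cancel_left _ he0, Nat.mul_div_cancel_left _ he0] at this
  have c2 : v₁.Coprime u₂ := by
    have := Nat.coprime_div_gcd_div_gcd (m := y₁) (n := x₂) hd0
    rw [← hd] at this
    rwa [hv₁, hu₂, Nat.mul_div_cancel_left _ hd0, Nat.mul_div_cancel_left _ hd0] at this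
  have c3 : u₁.Coprime v₁ := by
    rw [hu₁, hv₁] at hac
    exact hac.coprime_mul_left.coprime_mul_left_right
  have c4 : u₂.Coprime v₂ := by
    rw [hu₂, hv₂] at hbc
    exact hbc.coprime_mul_left.coprime_mul_left_right
  have e1 : x₁ / e = u₁ := by rw [hu₁, Nat.mul_div_cancel_left _ he0]
  have e2 : y₂ / e = v₂ := by rw [hv₂, Nat.mul_div_cancel_left _ he0]
  have e3 : y₁ / d = v₁ := by rw [hv₁, Nat.mul_div_cancel_left _ hd0]
  have e4 : x₂ / d = u₂ := by rw [hu₂, Nat.mul_div_cancel_left _ hd0]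
  rw [mem_fractionsIn]
  simp only [e1, e2, e3, e4]
  have p1 : 0 < u₁ := Nat.pos_of_ne_zero (by rintro rfl; omega)
  have p2 : 0 < u₂ := Nat.pos_of_ne_zero (by rintro rfl; omega)
  have p3 : 0 < v₁ := Nat.pos_of_ne_zero (by rintro rfl; omega)
  have p4 : 0 < v₂ := Nat.pos_of_ne_zero (by rintro rfl; omega)
  have l1 : u₁ ≤ m := le_trans (e1 ▸ Nat.div_le_self _ _) h2
  have l2 : u₂ ≤ n := le_trans (e4 ▸ Nat.div_le_self _ _) k2
  have l3 : v₁ ≤ m := le_trans (e3 ▸ Nat.div_le_self _ _) h4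
  have l4 : v₂ ≤ n := le_trans (e2 ▸ Nat.div_le_self _ _) k4
  refine ⟨⟨⟨Nat.mul_pos p1 p2, Nat.mul_le_mul l1 l2⟩, Nat.mul_pos p3 p4, Nat.mul_le_mul l3 l4⟩,
    ?_, g * g', mul_mem hg hg', ?_⟩
  · exact Nat.Coprime.mul_left (c3.mul_right c1) (c2.symm.mul_right c4)
  · have hde : ((d : ZMod p) * (e : ZMod p)) ≠ 0 := by
      rw [hv₁, Nat.cast_mul] at ha0
      rw [hv₂, Nat.cast_mul] at hb0
      exact mul_ne_zero (left_ne_zero_of_mul ha0.2) (left_ne_zero_of_mul hb0.2)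
    refine mul_left_cancel₀ hde ?_
    have f1 : (y₁ : ZMod p) = d * v₁ := by rw [← Nat.cast_mul, ← hv₁]
    have f2 : (y₂ : ZMod p) = e * v₂ := by rw [← Nat.cast_mul, ← hv₂]
    have f3 : (x₁ : ZMod p) = e * u₁ := by rw [← Nat.cast_mul, ← hu₁]
    have f4 : (x₂ : ZMod p) = d * u₂ := by rw [← Nat.cast_mul, ← hu₂]
    rw [f1, f3] at hga
    rw [f2, f4] at hgb
    push_cast
    linear_combination (e : ZMod p) * v₂ * hga + (g : ZMod p) * e * u₁ * hgb

/-- Products of reduced fractions are numerous: cancellation is governed by the label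
`(gcd(y₁, x₂), gcd(x₁, y₂))`, for which each factor leaves few choices. -/
theorem card_fractionsIn_mul_le {m n T : ℕ} (hn : 1 ≤ n) (hm : 1 ≤ m)
    (hT : ∀ k, 1 ≤ k → k ≤ m * n → #k.divisors ≤ T) :
    #(fractionsIn Γ m) * #(fractionsIn Γ n) ≤ T ^ 6 * #(fractionsIn Γ (m * n)) := by
  have hmle : m ≤ m * n := Nat.le_mul_of_pos_right m hn
  have hnle : n ≤ m * n := Nat.le_mul_of_pos_left n hm
  refine (card_mul_card_le_of_label (T := T ^ 2) (T' := T ^ 2) (fractionsIn Γ m) (fractionsIn Γ n)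
    (fun a b ↦ (a.2.gcd b.1, a.1.gcd b.2)) (fun a ↦ a.2.divisors ×ˢ a.1.divisors)
    (fun b ↦ b.1.divisors ×ˢ b.2.divisors) reducedMul (fractionsIn Γ (m * n))
    ?_ ?_ ?_ ?_ (fun a ha b hb ↦ reducedMul_mem ha hb) ?_).trans (le_of_eq (by ring))
  · intro a ha
    obtain ⟨⟨⟨h1, h2⟩, h3, h4⟩, -⟩ := mem_fractionsIn.1 ha
    rw [card_product, sq]
    exact Nat.mul_le_mul (hT _ h3 (h4.trans hmle)) (hT _ h1 (h2.trans hmle))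
  · intro a ha
    obtain ⟨⟨⟨h1, h2⟩, h3, h4⟩, -⟩ := mem_fractionsIn.1 ha
    rw [card_product, sq]
    exact Nat.mul_le_mul (hT _ h1 (h2.trans hnle)) (hT _ h3 (h4.trans hnle))
  · intro a ha b hb
    obtain ⟨⟨⟨h1, h2⟩, h3, h4⟩, -⟩ := mem_fractionsIn.1 ha
    exact mem_product.2 ⟨Nat.mem_divisors.2 ⟨Nat.gcd_dvd_left _ _, by omega⟩,
      Nat.mem_divisors.2 ⟨Nat.gcd_dvd_left _ _, by omega⟩⟩
  · intro a ha b hb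
    obtain ⟨⟨⟨h1, h2⟩, h3, h4⟩, -⟩ := mem_fractionsIn.1 hb
    exact mem_product.2 ⟨Nat.mem_divisors.2 ⟨Nat.gcd_dvd_right _ _, by omega⟩,
      Nat.mem_divisors.2 ⟨Nat.gcd_dvd_right _ _, by omega⟩⟩
  · rintro ⟨d, e⟩ ⟨X, Y⟩ hXY
    obtain ⟨⟨⟨h1, h2⟩, h3, h4⟩, -⟩ := mem_fractionsIn.1 hXY
    refine le_trans (card_le_card_of_injOn (t := X.divisors ×ˢ Y.divisors)
      (fun x ↦ (x.1.1 / e, x.1.2 / d)) (fun x hx ↦ ?_) fun x hx y hy hxy ↦ ?_)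
      (by rw [card_product, sq]; exact Nat.mul_le_mul (hT _ h1 h2) (hT _ h3 h4))
    · obtain ⟨-, hlab, hprod⟩ := mem_filter.1 hx
      simp only [Prod.mk.injEq, reducedMul] at hlab hprod
      rw [hlab.1, hlab.2] at hprod
      exact mem_product.2 ⟨Nat.mem_divisors.2 ⟨Dvd.intro _ hprod.1, by simp at h1; omega⟩,
        Nat.mem_divisors.2 ⟨Dvd.intro _ hprod.2, by simp at h3; omega⟩⟩
    · obtain ⟨-, hlab, hprod⟩ := mem_filter.1 hx
      obtain ⟨-, hlab', hprod'⟩ := mem_filter.1 hy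
      obtain ⟨⟨x₁, y₁⟩, ⟨x₂, y₂⟩⟩ := x
      obtain ⟨⟨x₁', y₁'⟩, ⟨x₂', y₂'⟩⟩ := y
      simp only [Prod.mk.injEq, reducedMul] at hlab hprod hlab' hprod' hxy h1 h3
      rw [hlab.1, hlab.2] at hprod
      rw [hlab'.1, hlab'.2] at hprod'
      have dv1 : d ∣ y₁ := hlab.1 ▸ Nat.gcd_dvd_left _ _
      have dv2 : d ∣ x₂ := hlab.1 ▸ Nat.gcd_dvd_right _ _
      have dv3 : e ∣ x₁ := hlab.2 ▸ Nat.gcd_dvd_left _ _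
      have dv4 : e ∣ y₂ := hlab.2 ▸ Nat.gcd_dvd_right _ _
      have dv1' : d ∣ y₁' := hlab'.1 ▸ Nat.gcd_dvd_left _ _
      have dv2' : d ∣ x₂' := hlab'.1 ▸ Nat.gcd_dvd_right _ _
      have dv3' : e ∣ x₁' := hlab'.2 ▸ Nat.gcd_dvd_left _ _
      have dv4' : e ∣ y₂' := hlab'.2 ▸ Nat.gcd_dvd_right _ _
      have q1 : x₂ / d = x₂' / d := by
        have : x₁ / e * (x₂ / d) = x₁ / e * (x₂' / d) := by rw [hprod.1, hxy.1, hprod'.1]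
        refine Nat.eq_of_mul_eq_mul_left (Nat.pos_of_ne_zero fun h ↦ ?_) this
        rw [h, zero_mul] at hprod; omega
      have q2 : y₂ / e = y₂' / e := by
        have : y₁ / d * (y₂ / e) = y₁ / d * (y₂' / e) := by rw [hprod.2, hxy.2, hprod'.2]
        refine Nat.eq_of_mul_eq_mul_left (Nat.pos_of_ne_zero fun h ↦ ?_) this
        rw [h, zero_mul] at hprod; omega
      rw [Nat.div_left_inj dv2 dv2'] at q1
      rw [Nat.div_left_inj dv4 dv4'] at q2
      rw [Nat.div_left_inj dv3 dv3', Nat.div_left_inj dv1 dv1'] at hxy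
      rw [hxy.1, hxy.2, q1, q2]

theorem card_fractionsIn_pow_le {n T : ℕ} (hn : 1 ≤ n) (k : ℕ)
    (hT : ∀ j, 1 ≤ j → j ≤ n ^ k → #j.divisors ≤ T) :
    #(fractionsIn Γ n) ^ k ≤ T ^ (6 * k) * #(fractionsIn Γ (n ^ k)) := by
  induction k with
  | zero =>
    have : (1, 1) ∈ fractionsIn Γ (n ^ 0) := by
      rw [mem_fractionsIn]; exact ⟨by simp, by simp, 1, one_mem _, by simp⟩
    simpa using card_pos.2 ⟨_, this⟩
  | succ k ih =>
    have hk : 1 ≤ n ^ k := Nat.one_le_pow _ _ hn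
    have h1 := ih fun j hj1 hj2 ↦ hT j hj1 (hj2.trans (Nat.pow_le_pow_right hn (Nat.le_succ k)))
    have h2 := card_fractionsIn_mul_le (Γ := Γ) hn hk (T := T) hT
    calc #(fractionsIn Γ n) ^ (k + 1) = #(fractionsIn Γ n) ^ k * #(fractionsIn Γ n) := pow_succ _ _
      _ ≤ T ^ (6 * k) * #(fractionsIn Γ (n ^ k)) * #(fractionsIn Γ n) := by gcongr
      _ = T ^ (6 * k) * (#(fractionsIn Γ (n ^ k)) * #(fractionsIn Γ n)) := by ring
      _ ≤ T ^ (6 * k) * (T ^ 6 * #(fractionsIn Γ (n ^ k * n))) := by gcongr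
      _ = T ^ (6 * (k + 1)) * #(fractionsIn Γ (n ^ (k + 1))) := by rw [pow_succ n k]; ring

/-- Reduced fractions `y / x ≤ 1` of height at most `Z` whose differences have numerators divisible
by `p` are spaced by at least `p / Z ^ 2`. -/
theorem card_le_of_dvd_det {Z : ℕ} (s : Finset (ℕ × ℕ))
    (hs : ∀ x ∈ s, 1 ≤ x.1 ∧ x.1 ≤ Z ∧ x.2 ≤ x.1 ∧ x.1.Coprime x.2)
    (hdet : ∀ x ∈ s, ∀ y ∈ s, ((x.2 * y.1 : ℕ) : ZMod p) = ((y.2 * x.1 : ℕ) : ZMod p)) :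
    #s ≤ Z ^ 2 / p + 1 := by
  have hp : 0 < p := (Fact.out : p.Prime).pos
  have hp0 : (0 : ℝ) < p := by exact_mod_cast hp
  rw [← card_range (Z ^ 2 / p + 1)]
  have key : ∀ x ∈ s, ∀ y ∈ s, y.2 * x.1 < x.2 * y.1 →
      ⌊((y.2 : ℝ) * Z ^ 2) / (y.1 * p)⌋₊ + 1 ≤ ⌊((x.2 : ℝ) * Z ^ 2) / (x.1 * p)⌋₊ := by
    intro x hx y hy hlt
    obtain ⟨hx1, hx2, -⟩ := hs x hx
    obtain ⟨hy1, hy2, -⟩ := hs y hy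
    have hx1' : (0 : ℝ) < x.1 := by exact_mod_cast hx1
    have hy1' : (0 : ℝ) < y.1 := by exact_mod_cast hy1
    rw [← Nat.floor_add_one (by positivity)]
    refine Nat.floor_le_floor ?_
    have h1 : y.2 * x.1 + p ≤ x.2 * y.1 := by
      have := (ZMod.natCast_eq_natCast_iff _ _ _).1 (hdet x hx y hy).symm
      have := Nat.le_of_dvd (by omega) ((Nat.modEq_iff_dvd' hlt.le).1 this)
      omega
    have h2 : (y.2 : ℝ) * x.1 + p ≤ x.2 * y.1 := by exact_mod_cast h1
    have h3 : (x.1 : ℝ) * y.1 ≤ Z ^ 2 := by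
      rw [sq]; exact_mod_cast Nat.mul_le_mul hx2 hy2
    rw [div_add_one (by positivity), div_le_div_iff₀ (by positivity) (by positivity)]
    have h4 : ((y.2 : ℝ) * x.1 + p) * Z ^ 2 ≤ x.2 * y.1 * Z ^ 2 := by gcongr
    have h5 : (p : ℝ) * (x.1 * y.1) ≤ p * Z ^ 2 := by gcongr
    nlinarith
  refine card_le_card_of_injOn (fun x ↦ ⌊((x.2 : ℝ) * Z ^ 2) / (x.1 * p)⌋₊) (fun x hx ↦ ?_)
    fun x hx y hy hxy ↦ ?_
  · obtain ⟨h1, h2, h3, -⟩ := hs x hx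
    have h1' : (0 : ℝ) < x.1 := by exact_mod_cast h1
    rw [coe_range, Set.mem_Iio, Nat.lt_succ_iff, Nat.le_div_iff_mul_le hp]
    have := Nat.floor_le (a := ((x.2 : ℝ) * Z ^ 2) / (x.1 * p)) (by positivity)
    have h4 : ((x.2 : ℝ) * Z ^ 2) / (x.1 * p) ≤ (Z : ℝ) ^ 2 / p := by
      rw [div_le_div_iff₀ (by positivity) hp0]
      have : (x.2 : ℝ) ≤ x.1 := by exact_mod_cast h3
      calc (x.2 : ℝ) * Z ^ 2 * p ≤ x.1 * Z ^ 2 * p := by gcongr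
        _ = (Z : ℝ) ^ 2 * (x.1 * p) := by ring
    have h5 := this.trans h4
    rw [le_div_iff₀ hp0] at h5
    exact_mod_cast h5
  · simp only at hxy
    have heq : y.2 * x.1 = x.2 * y.1 := by
      rcases lt_trichotomy (y.2 * x.1) (x.2 * y.1) with h | h | h
      · have := key x hx y hy h; omega
      · exact h
      · have := key y hy x hx h; omega
    obtain ⟨hx1, -, -, hxc⟩ := hs x hx
    obtain ⟨hy1, -, -, hyc⟩ := hs y hy
    have d1 : x.1 ∣ y.1 := hxc.dvd_of_dvd_mul_left (Dvd.intro_left _ heq)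
    have d2 : y.1 ∣ x.1 := hyc.dvd_of_dvd_mul_left (Dvd.intro_left _ heq.symm)
    have e1 : x.1 = y.1 := Nat.dvd_antisymm d1 d2
    rw [e1] at heq
    exact Prod.ext e1 (Nat.eq_of_mul_eq_mul_right hy1 heq).symm

theorem card_fractionsIn_le (Z : ℕ) :
    #(fractionsIn Γ Z) ≤ 2 * Nat.card Γ * (Z ^ 2 / p + 1) := by
  classical
  set s : Γ → Finset (ℕ × ℕ) := fun g ↦
    {x ∈ fractionsIn Γ Z | (x.2 : ZMod p) = ((g : (ZMod p)ˣ) : ZMod p) * (x.1 : ZMod p)} with hs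
  have hsub : fractionsIn Γ Z ⊆ univ.biUnion s := by
    intro x hx
    obtain ⟨_, _, g, hg, hgx⟩ := mem_fractionsIn.1 hx
    exact mem_biUnion.2 ⟨⟨g, hg⟩, mem_univ _, mem_filter.2 ⟨hx, hgx⟩⟩
  have hcard : ∀ g, #(s g) ≤ 2 * (Z ^ 2 / p + 1) := by
    intro g
    rw [← card_filter_add_card_filter_not (s := s g) (fun x ↦ x.2 ≤ x.1), two_mul]
    refine add_le_add (card_le_of_dvd_det (p := p) _ ?_ ?_) ?_
    · intro x hx
      obtain ⟨hx, hle⟩ := mem_filter.1 hx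
      obtain ⟨⟨⟨h1, h2⟩, h3, h4⟩, hc, -⟩ := mem_fractionsIn.1 (mem_filter.1 hx).1
      exact ⟨h1, h2, hle, hc⟩
    · intro x hx y hy
      have h1 := (mem_filter.1 (mem_filter.1 hx).1).2
      have h2 := (mem_filter.1 (mem_filter.1 hy).1).2
      push_cast
      rw [h1, h2]; ring
    · rw [← card_image_of_injective _ Prod.swap_injective]
      refine card_le_of_dvd_det (p := p) _ ?_ ?_
      · intro x hx
        obtain ⟨x, hx', rfl⟩ := mem_image.1 hx
        obtain ⟨hx, hle⟩ := mem_filter.1 hx'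
        obtain ⟨⟨⟨h1, h2⟩, h3, h4⟩, hc, -⟩ := mem_fractionsIn.1 (mem_filter.1 hx).1
        exact ⟨h3, h4, (not_le.1 hle).le, hc.symm⟩
      · intro x hx y hy
        obtain ⟨x, hx', rfl⟩ := mem_image.1 hx
        obtain ⟨y, hy', rfl⟩ := mem_image.1 hy
        have h1 := (mem_filter.1 (mem_filter.1 hx').1).2
        have h2 := (mem_filter.1 (mem_filter.1 hy').1).2
        simp only [Prod.snd_swap, Prod.fst_swap]
        push_cast
        rw [h1, h2]; ring
  calc #(fractionsIn Γ Z) ≤ #(univ.biUnion s) := card_le_card hsub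
    _ ≤ ∑ g, #(s g) := card_biUnion_le
    _ ≤ #(univ : Finset Γ) • (2 * (Z ^ 2 / p + 1)) := sum_le_card_nsmul _ _ _ fun g _ ↦ hcard g
    _ = 2 * Nat.card Γ * (Z ^ 2 / p + 1) := by
        rw [smul_eq_mul, card_univ, Nat.card_eq_fintype_card]; ring

end Fractions

/-! ### Bounds in terms of powers of `p` -/

/-- The subgroup generated by `G` and `-1`. -/
def signClosure {R : Type*} [CommRing R] (G : Subgroup Rˣ) : Subgroup Rˣ where
  carrier := {u | u ∈ G ∨ -u ∈ G}
  mul_mem' := by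
    rintro a b (ha | ha) (hb | hb)
    · exact Or.inl (mul_mem ha hb)
    · right; simpa using mul_mem ha hb
    · right; simpa using mul_mem ha hb
    · left; simpa using mul_mem ha hb
  one_mem' := Or.inl (one_mem G)
  inv_mem' := by
    rintro a (ha | ha)
    · exact Or.inl (inv_mem ha)
    · right; simpa using inv_mem ha

theorem mem_signClosure {R : Type*} [CommRing R] {G : Subgroup Rˣ} {u : Rˣ} :
    u ∈ signClosure G ↔ u ∈ G ∨ -u ∈ G := Iff.rfl

theorem card_signClosure_le {R : Type*} [CommRing R] [Finite Rˣ] (G : Subgroup Rˣ) :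
    Nat.card (signClosure G) ≤ 2 * Nat.card G := by
  have h : ((signClosure G : Subgroup Rˣ) : Set Rˣ) = (G : Set Rˣ) ∪ (-·) '' (G : Set Rˣ) := by
    ext u
    simp only [SetLike.mem_coe, mem_signClosure, Set.mem_union, Set.mem_image]
    refine or_congr Iff.rfl ⟨fun h ↦ ⟨-u, h, neg_neg u⟩, ?_⟩
    rintro ⟨v, hv, rfl⟩
    simpa using hv
  rw [← SetLike.coe_sort_coe, Nat.card_coe_set_eq, h, ← SetLike.coe_sort_coe G, Nat.card_coe_set_eq,
    two_mul]
  exact (Set.ncard_union_le _ _).trans (add_le_add le_rfl (Set.ncard_image_le (Set.toFinite _)))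

theorem Subgroup.card_units_zmod_le {p : ℕ} [Fact p.Prime] (G : Subgroup (ZMod p)ˣ) :
    Nat.card G ≤ p := by
  refine (Subgroup.card_le_card_group G).trans ?_
  rw [Nat.card_eq_fintype_card, ZMod.card_units p]
  exact Nat.sub_le _ _

/-- The bound for the number of fractions of height `m` in `±G` that results from `k`-fold
products, which are fractions of height `m ^ k`. -/
theorem exists_card_fractionsIn_le_of_pow {k : ℕ} (hk : 1 ≤ k) {ε : ℝ} (hε : 0 < ε) :
    ∃ C : ℝ, 0 < C ∧ ∀ (p : ℕ) [Fact p.Prime] (G : Subgroup (ZMod p)ˣ) (m : ℕ), 1 ≤ m → m ≤ p →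
      (#(fractionsIn (signClosure G) m) : ℝ) ≤ C * (p : ℝ) ^ ε *
        ((Nat.card G : ℝ) ^ (1 / k : ℝ) * ((m : ℝ) ^ 2 * ((p : ℝ) ^ (1 / k : ℝ))⁻¹ + 1)) := by
  have hk0 : (0 : ℝ) < k := by exact_mod_cast hk
  obtain ⟨C, hC1, hC⟩ := exists_card_divisors_le_rpow (ε := ε / (6 * k)) (by positivity)
  refine ⟨4 * C ^ 6, by positivity, fun p _ G m hm hmp ↦ ?_⟩
  have hp : 0 < p := (Fact.out : p.Prime).pos
  have hp0 : (0 : ℝ) < p := by exact_mod_cast hp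
  set t : ℝ := ((Nat.card G : ℕ) : ℝ)
  set A := #(fractionsIn (signClosure G) m)
  set T := ⌊C * (p : ℝ) ^ (ε / 6)⌋₊ with hT
  have hTle : (T : ℝ) ≤ C * (p : ℝ) ^ (ε / 6) := Nat.floor_le (by positivity)
  have hpow : A ^ k ≤ T ^ (6 * k) * #(fractionsIn (signClosure G) (m ^ k)) := by
    refine card_fractionsIn_pow_le hm k fun j hj1 hj2 ↦ Nat.le_floor ((hC j (by omega)).trans ?_)
    gcongr
    have hjp : (j : ℝ) ≤ (p : ℝ) ^ k := by
      exact_mod_cast hj2.trans (Nat.pow_le_pow_left hmp k)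
    calc (j : ℝ) ^ (ε / (6 * k)) ≤ ((p : ℝ) ^ k) ^ (ε / (6 * k)) := by gcongr
      _ = (p : ℝ) ^ (ε / 6) := by
          rw [← Real.rpow_natCast, ← Real.rpow_mul hp0.le]
          congr 1; field_simp
  have hlast : (#(fractionsIn (signClosure G) (m ^ k)) : ℝ) ≤ 4 * t * ((m : ℝ) ^ (2 * k) / p + 1) := by
    have h1 : (#(fractionsIn (signClosure G) (m ^ k)) : ℝ) ≤
        ((2 * (2 * Nat.card G) * ((m ^ k) ^ 2 / p + 1) : ℕ) : ℝ) := by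
      refine Nat.cast_le.2 ((card_fractionsIn_le _).trans ?_)
      gcongr
      exact card_signClosure_le G
    refine h1.trans ?_
    push_cast
    have h2 : (((m ^ k) ^ 2 / p : ℕ) : ℝ) ≤ (m : ℝ) ^ (2 * k) / p := by
      refine Nat.cast_div_le.trans (le_of_eq ?_)
      push_cast
      rw [← pow_mul, mul_comm k 2]
    calc 2 * (2 * t) * ((((m ^ k) ^ 2 / p : ℕ) : ℝ) + 1)
        ≤ 2 * (2 * t) * ((m : ℝ) ^ (2 * k) / p + 1) := by gcongr
      _ = _ := by ring
  refine le_of_pow_le_pow_left₀ (n := k) (by omega) (by positivity) ?_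
  have hroot : ∀ x : ℝ, 0 ≤ x → (x ^ (1 / k : ℝ)) ^ k = x := fun x hx ↦ by
    rw [← Real.rpow_natCast, ← Real.rpow_mul hx, one_div_mul_cancel hk0.ne', Real.rpow_one]
  have h4 : (4 : ℝ) ≤ 4 ^ k := by simpa using pow_le_pow_right₀ (by norm_num : (1 : ℝ) ≤ 4) hk
  have hsum : (m : ℝ) ^ (2 * k) / p + 1 ≤ ((m : ℝ) ^ 2 * ((p : ℝ) ^ (1 / k : ℝ))⁻¹ + 1) ^ k := by
    calc (m : ℝ) ^ (2 * k) / p + 1 = ((m : ℝ) ^ 2 * ((p : ℝ) ^ (1 / k : ℝ))⁻¹) ^ k + 1 ^ k := by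
          rw [mul_pow, inv_pow, hroot _ hp0.le, ← pow_mul, one_pow, div_eq_mul_inv]
      _ ≤ _ := pow_add_pow_le (by positivity) (by norm_num) (by omega)
  have hTp : (T : ℝ) ^ (6 * k) ≤ (C ^ 6) ^ k * ((p : ℝ) ^ ε) ^ k := by
    calc (T : ℝ) ^ (6 * k) ≤ (C * (p : ℝ) ^ (ε / 6)) ^ (6 * k) := by gcongr
      _ = (C ^ 6) ^ k * (((p : ℝ) ^ (ε / 6)) ^ 6) ^ k := by rw [pow_mul, mul_pow, mul_pow]
      _ = _ := by
          congr 2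
          rw [← Real.rpow_natCast, ← Real.rpow_mul hp0.le]
          congr 1; push_cast; ring
  calc (A : ℝ) ^ k ≤ (T : ℝ) ^ (6 * k) * #(fractionsIn (signClosure G) (m ^ k)) := by
        exact_mod_cast hpow
    _ ≤ ((C ^ 6) ^ k * ((p : ℝ) ^ ε) ^ k) * (4 ^ k * t *
        ((m : ℝ) ^ 2 * ((p : ℝ) ^ (1 / k : ℝ))⁻¹ + 1) ^ k) := by
        refine mul_le_mul hTp (hlast.trans ?_) (by positivity) (by positivity)
        gcongr
    _ = _ := by
        rw [mul_pow, mul_pow, mul_pow, mul_pow, hroot t (Nat.cast_nonneg _)]; ring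

section Exponents

variable {t p : ℝ} {ν k : ℕ}

/-- For `t ≥ √p` the quantity `t ^ (1 / k) * (t / p) ^ (1 / (k + 1))` decreases with `k`. -/
theorem rpow_mul_rpow_antitone (hp : 1 < p) (ht : 0 < t) (htp : t ≤ p) (hpt : p ≤ t ^ 2)
    (hν : 1 ≤ ν) (hk : ν ≤ k) :
    t ^ (1 / (k : ℝ)) * (t / p) ^ (1 / ((k : ℝ) + 1)) ≤
      t ^ (1 / (ν : ℝ)) * (t / p) ^ (1 / ((ν : ℝ) + 1)) := by
  have hp0 : 0 < p := by linarith
  have h1 : Real.log p ≤ 2 * Real.log t := by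
    have := Real.log_le_log hp0 hpt
    rwa [Real.log_pow] at this
  have h2 : Real.log t ≤ Real.log p := Real.log_le_log ht htp
  have hν0 : (0 : ℝ) < ν := by exact_mod_cast hν
  have hk' : (ν : ℝ) ≤ k := by exact_mod_cast hk
  have hk0 : (0 : ℝ) < k := hν0.trans_le hk'
  rw [Real.rpow_def_of_pos ht, Real.rpow_def_of_pos ht, Real.rpow_def_of_pos (div_pos ht hp0),
    Real.rpow_def_of_pos (div_pos ht hp0), ← Real.exp_add, ← Real.exp_add,
    Real.log_div ht.ne' hp0.ne', Real.exp_le_exp]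
  have e1 : 1 / (ν : ℝ) - 1 / k = (k - ν) / (ν * k) := by field_simp
  have e2 : 1 / ((ν : ℝ) + 1) - 1 / ((k : ℝ) + 1) = (k - ν) / ((ν + 1) * (k + 1)) := by
    field_simp; ring
  have e3 : 0 ≤ (k - ν) / (((ν : ℝ) + 1) * (k + 1)) := div_nonneg (by linarith) (by positivity)
  have e4 : (k - ν) / (((ν : ℝ) + 1) * (k + 1)) ≤ (k - ν) / ((ν : ℝ) * k) := by
    apply div_le_div_of_nonneg_left (by linarith) (by positivity)
    gcongr <;> linarith
  have h3 : (Real.log p - Real.log t) * ((k - ν) / (((ν : ℝ) + 1) * (k + 1))) ≤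
      Real.log t * ((k - ν) / ((ν : ℝ) * k)) :=
    mul_le_mul (by linarith) e4 e3 (by linarith)
  rw [← e1, ← e2] at h3
  linarith

theorem rpow_le_rpow_mul_rpow (hp : 1 < p) (ht : 0 < t) (hpt : p ≤ t ^ 2) (hν : 1 ≤ ν) :
    p ^ (1 / (2 * (ν : ℝ) * (ν + 1))) ≤ t ^ (1 / (ν : ℝ)) * (t / p) ^ (1 / ((ν : ℝ) + 1)) := by
  have hp0 : 0 < p := by linarith
  have h1 : Real.log p ≤ 2 * Real.log t := by
    have := Real.log_le_log hp0 hpt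
    rwa [Real.log_pow] at this
  have hν0 : (0 : ℝ) < ν := by exact_mod_cast hν
  rw [Real.rpow_def_of_pos ht, Real.rpow_def_of_pos hp0, Real.rpow_def_of_pos (div_pos ht hp0),
    ← Real.exp_add, Real.log_div ht.ne' hp0.ne', Real.exp_le_exp]
  have e : Real.log t * (1 / (ν : ℝ)) + (Real.log t - Real.log p) * (1 / ((ν : ℝ) + 1)) -
      Real.log p * (1 / (2 * (ν : ℝ) * (ν + 1))) =
      (2 * Real.log t - Real.log p) * ((2 * ν + 1) / (2 * (ν : ℝ) * (ν + 1))) := by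
    field_simp; ring
  have : 0 ≤ (2 * Real.log t - Real.log p) * ((2 * ν + 1) / (2 * (ν : ℝ) * (ν + 1))) :=
    mul_nonneg (by linarith) (by positivity)
  linarith

end Exponents

/-- The number of fractions of height `m` in `±G`. According to the size of `m`, this uses `k`-fold
and `(k + 1)`-fold products with `m ^ (2 * k) ≤ p ≤ m ^ (2 * (k + 1))`. -/
theorem exists_card_fractionsIn_le {ν : ℕ} (hν : 1 ≤ ν) {ε : ℝ} (hε : 0 < ε) :
    ∃ C : ℝ, 0 < C ∧ ∀ (p : ℕ) [Fact p.Prime] (G : Subgroup (ZMod p)ˣ), p ≤ Nat.card G ^ 2 →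
      ∀ m : ℕ, 1 ≤ m → m ≤ p → (#(fractionsIn (signClosure G) m) : ℝ) ≤ C * (p : ℝ) ^ ε *
        (((Nat.card G : ℝ) / p) ^ (1 / (ν : ℝ)) * (m : ℝ) ^ 2 +
          √((Nat.card G : ℝ) ^ (1 / (ν : ℝ)) * ((Nat.card G : ℝ) / p) ^ (1 / ((ν : ℝ) + 1))) * m) := by
  have hex : ∀ k : ℕ, ∃ C : ℝ, 0 < C ∧ (1 ≤ k → ∀ (p : ℕ) [Fact p.Prime] (G : Subgroup (ZMod p)ˣ)
      (m : ℕ), 1 ≤ m → m ≤ p → (#(fractionsIn (signClosure G) m) : ℝ) ≤ C * (p : ℝ) ^ ε *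
        ((Nat.card G : ℝ) ^ (1 / k : ℝ) * ((m : ℝ) ^ 2 * ((p : ℝ) ^ (1 / k : ℝ))⁻¹ + 1))) := by
    intro k
    by_cases hk : 1 ≤ k
    · obtain ⟨C, h1, h2⟩ := exists_card_fractionsIn_le_of_pow hk hε
      exact ⟨C, h1, fun _ ↦ h2⟩
    · exact ⟨1, one_pos, fun h ↦ absurd h hk⟩
  choose c hc0 hc using hex
  set K := 2 * ν * (ν + 1) with hK
  have hνK : ν + 1 ≤ K := by rw [hK]; nlinarith
  set C := ∑ k ∈ range (K + 1), c k with hC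
  have hcC : ∀ k ≤ K, c k ≤ C := fun k hk ↦
    single_le_sum (fun i _ ↦ (hc0 i).le) (mem_range.2 (Nat.lt_succ_of_le hk))
  have hC0 : 0 < C := (hc0 0).trans_le (hcC 0 (Nat.zero_le _))
  refine ⟨2 * C + 1, by positivity, fun p _ G hpt m hm hmp ↦ ?_⟩
  have hp1 : (1 : ℝ) < p := by exact_mod_cast (Fact.out : p.Prime).one_lt
  have hp0 : (0 : ℝ) < p := by linarith
  have ht0 : (0 : ℝ) < Nat.card G := by exact_mod_cast Nat.card_pos
  have htp : (Nat.card G : ℝ) ≤ p := by exact_mod_cast G.card_units_zmod_le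
  have hpt' : (p : ℝ) ≤ (Nat.card G : ℝ) ^ 2 := by exact_mod_cast hpt
  have hm1 : (1 : ℝ) ≤ m := by exact_mod_cast hm
  have hm0 : (0 : ℝ) < m := by linarith
  have hpε : 1 ≤ (p : ℝ) ^ ε := Real.one_le_rpow hp1.le hε.le
  have hlarge : ∀ k, 1 ≤ k → k ≤ K → p ≤ m ^ (2 * k) →
      (#(fractionsIn (signClosure G) m) : ℝ) ≤
        2 * C * (p : ℝ) ^ ε * (((Nat.card G : ℝ) / p) ^ (1 / (k : ℝ)) * (m : ℝ) ^ 2) := by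
    intro k hk hkK hpm
    have hk0 : (0 : ℝ) < k := by exact_mod_cast hk
    have h1 : (p : ℝ) ^ (1 / k : ℝ) ≤ (m : ℝ) ^ 2 := by
      have : (p : ℝ) ≤ ((m : ℝ) ^ 2) ^ (k : ℝ) := by
        rw [Real.rpow_natCast, ← pow_mul]; exact_mod_cast hpm
      calc (p : ℝ) ^ (1 / k : ℝ) ≤ (((m : ℝ) ^ 2) ^ (k : ℝ)) ^ (1 / k : ℝ) := by gcongr
        _ = (m : ℝ) ^ 2 := by
          rw [← Real.rpow_mul (by positivity), mul_one_div_cancel hk0.ne', Real.rpow_one]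
    have h2 : (1 : ℝ) ≤ (m : ℝ) ^ 2 * ((p : ℝ) ^ (1 / k : ℝ))⁻¹ := by
      rw [← div_eq_mul_inv, one_le_div (by positivity)]; exact h1
    refine (hc k hk p G m hm hmp).trans ?_
    calc c k * (p : ℝ) ^ ε * ((Nat.card G : ℝ) ^ (1 / k : ℝ) *
          ((m : ℝ) ^ 2 * ((p : ℝ) ^ (1 / k : ℝ))⁻¹ + 1))
        ≤ C * (p : ℝ) ^ ε * ((Nat.card G : ℝ) ^ (1 / k : ℝ) *
          ((m : ℝ) ^ 2 * ((p : ℝ) ^ (1 / k : ℝ))⁻¹ +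
            (m : ℝ) ^ 2 * ((p : ℝ) ^ (1 / k : ℝ))⁻¹)) := by
          gcongr
          exact hcC k hkK
      _ = _ := by rw [Real.div_rpow ht0.le hp0.le]; field_simp; ring
  have hsmall : ∀ k, 1 ≤ k → k ≤ K → m ^ (2 * k) ≤ p →
      (#(fractionsIn (signClosure G) m) : ℝ) ≤
        2 * C * (p : ℝ) ^ ε * (Nat.card G : ℝ) ^ (1 / (k : ℝ)) := by
    intro k hk hkK hpm
    have hk0 : (0 : ℝ) < k := by exact_mod_cast hk
    have h1 : (m : ℝ) ^ 2 ≤ (p : ℝ) ^ (1 / k : ℝ) := by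
      have : ((m : ℝ) ^ 2) ^ (k : ℝ) ≤ p := by
        rw [Real.rpow_natCast, ← pow_mul]; exact_mod_cast hpm
      calc (m : ℝ) ^ 2 = (((m : ℝ) ^ 2) ^ (k : ℝ)) ^ (1 / k : ℝ) := by
            rw [← Real.rpow_mul (by positivity), mul_one_div_cancel hk0.ne', Real.rpow_one]
        _ ≤ _ := by gcongr
    have h2 : (m : ℝ) ^ 2 * ((p : ℝ) ^ (1 / k : ℝ))⁻¹ ≤ 1 := by
      rw [← div_eq_mul_inv, div_le_one (by positivity)]; exact h1
    refine (hc k hk p G m hm hmp).trans ?_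
    calc c k * (p : ℝ) ^ ε * ((Nat.card G : ℝ) ^ (1 / k : ℝ) *
          ((m : ℝ) ^ 2 * ((p : ℝ) ^ (1 / k : ℝ))⁻¹ + 1))
        ≤ C * (p : ℝ) ^ ε * ((Nat.card G : ℝ) ^ (1 / k : ℝ) * (1 + 1)) := by
          gcongr
          exact hcC k hkK
      _ = _ := by ring
  set t : ℝ := ((Nat.card G : ℕ) : ℝ) with ht
  set α := (t / p) ^ (1 / (ν : ℝ)) with hα
  set F := t ^ (1 / (ν : ℝ)) * (t / p) ^ (1 / ((ν : ℝ) + 1)) with hF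
  have hα0 : 0 ≤ α := by positivity
  have hF0 : 0 < F := by positivity
  by_cases h1 : p ≤ m ^ (2 * ν)
  · calc _ ≤ 2 * C * (p : ℝ) ^ ε * (α * (m : ℝ) ^ 2) := hlarge ν hν (by omega) h1
      _ ≤ (2 * C + 1) * (p : ℝ) ^ ε * (α * (m : ℝ) ^ 2 + √F * m) := by
          gcongr
          · linarith
          · exact le_add_of_nonneg_right (by positivity)
  by_cases h2 : m ^ (2 * K) ≤ p
  · have h3 : (m : ℝ) ≤ √F := by
      refine Real.le_sqrt_of_sq_le ?_
      have hν0 : (0 : ℝ) < ν := by exact_mod_cast hν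
      refine le_trans ?_ (rpow_le_rpow_mul_rpow hp1 ht0 hpt' hν)
      have hK0 : (0 : ℝ) < K := by
        have : 0 < K := by omega
        exact_mod_cast this
      have e : (K : ℝ) = 2 * (ν : ℝ) * (ν + 1) := by rw [hK]; push_cast; ring
      rw [← e]
      calc (m : ℝ) ^ 2 = (((m : ℝ) ^ 2) ^ (K : ℝ)) ^ (1 / K : ℝ) := by
            rw [← Real.rpow_mul (by positivity), mul_one_div_cancel hK0.ne', Real.rpow_one]
        _ ≤ (p : ℝ) ^ (1 / K : ℝ) := by
            gcongr
            rw [Real.rpow_natCast, ← pow_mul]; exact_mod_cast h2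
    have h4 : (#(fractionsIn (signClosure G) m) : ℝ) ≤ m * m := by
      have : #(fractionsIn (signClosure G) m) ≤ m * m := by
        refine (card_le_card (t := Icc 1 m ×ˢ Icc 1 m) fun x hx ↦ ?_).trans (by simp)
        obtain ⟨⟨h1, h2⟩, -⟩ := mem_fractionsIn.1 hx
        exact mem_product.2 ⟨mem_Icc.2 h1, mem_Icc.2 h2⟩
      exact_mod_cast this
    calc (#(fractionsIn (signClosure G) m) : ℝ) ≤ 1 * 1 * (√F * m) := by
          rw [one_mul, one_mul]; exact h4.trans (by gcongr)
      _ ≤ (2 * C + 1) * (p : ℝ) ^ ε * (α * (m : ℝ) ^ 2 + √F * m) := by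
          gcongr
          · linarith
          · exact le_add_of_nonneg_left (by positivity)
  · have hexj : ∃ j, p ≤ m ^ (2 * j) := ⟨K, (not_le.1 h2).le⟩
    classical
    set j := Nat.find hexj with hj
    have hj1 : p ≤ m ^ (2 * j) := Nat.find_spec hexj
    have hjK : j ≤ K := Nat.find_min' hexj (not_le.1 h2).le
    have hjν : ν < j := by
      by_contra h
      exact h1 (hj1.trans (Nat.pow_le_pow_right hm (by omega)))
    obtain ⟨k, hk⟩ : ∃ k, j = k + 1 := ⟨j - 1, by omega⟩
    have hk1 : m ^ (2 * k) ≤ p := (not_le.1 (Nat.find_min hexj (m := k) (by omega))).le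
    have b1 := hsmall k (by omega) (by omega) hk1
    have b2 := hlarge j (by omega) hjK hj1
    have b3 : (#(fractionsIn (signClosure G) m) : ℝ) ≤ 2 * C * (p : ℝ) ^ ε * (√F * m) := by
      refine le_of_pow_le_pow_left₀ (n := 2) (by norm_num) (by positivity) ?_
      calc (#(fractionsIn (signClosure G) m) : ℝ) ^ 2
          = #(fractionsIn (signClosure G) m) * #(fractionsIn (signClosure G) m) := sq _
        _ ≤ (2 * C * (p : ℝ) ^ ε * t ^ (1 / (k : ℝ))) *
            (2 * C * (p : ℝ) ^ ε * ((t / p) ^ (1 / (j : ℝ)) * (m : ℝ) ^ 2)) :=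
            mul_le_mul b1 b2 (by positivity) (by positivity)
        _ = (2 * C * (p : ℝ) ^ ε) ^ 2 * (t ^ (1 / (k : ℝ)) * (t / p) ^ (1 / ((k : ℝ) + 1))) *
            (m : ℝ) ^ 2 := by rw [hk]; push_cast; ring
        _ ≤ (2 * C * (p : ℝ) ^ ε) ^ 2 * F * (m : ℝ) ^ 2 := by
            gcongr
            exact rpow_mul_rpow_antitone hp1 ht0 htp hpt' hν (by omega)
        _ = (2 * C * (p : ℝ) ^ ε * (√F * m)) ^ 2 := by
            rw [mul_pow _ (√F * m), mul_pow (√F), Real.sq_sqrt hF0.le]; ring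
    calc _ ≤ _ := b3
      _ ≤ (2 * C + 1) * (p : ℝ) ^ ε * (α * (m : ℝ) ^ 2 + √F * m) := by
          gcongr
          · linarith
          · exact le_add_of_nonneg_left (by positivity)

/-! ### Pairs of small residues -/

section SmallPairs

variable {p : ℕ} [Fact p.Prime]

/-- The distance of a residue from `0`, an integer in `[0, p / 2]`. -/
def residueAbs (a : ZMod p) : ℕ := a.valMinAbs.natAbs

theorem residueAbs_pos {a : ZMod p} (ha : a ≠ 0) : 0 < residueAbs a := by
  rw [residueAbs, Int.natAbs_pos]
  exact fun h ↦ ha (ZMod.valMinAbs_eq_zero a |>.1 h)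

theorem residueAbs_le (a : ZMod p) : residueAbs a ≤ p / 2 := ZMod.natAbs_valMinAbs_le a

theorem eq_or_eq_neg_residueAbs (a : ZMod p) :
    a = (residueAbs a : ZMod p) ∨ a = -(residueAbs a : ZMod p) := by
  have h := ZMod.coe_valMinAbs a
  rcases Int.natAbs_eq a.valMinAbs with h1 | h1
  · left
    exact h.symm.trans ((congrArg (Int.cast : ℤ → ZMod p) h1).trans (Int.cast_natCast _))
  · right
    refine h.symm.trans ((congrArg (Int.cast : ℤ → ZMod p) h1).trans ?_)
    rw [Int.cast_neg, Int.cast_natCast, residueAbs]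

variable (G : Subgroup (ZMod p)ˣ)

open Classical in
/-- The pairs `(g, a)` with `g ∈ G` and `a ≠ 0` such that both `a` and `g a` are at distance at
most `n` from `0`. -/
noncomputable def smallPairs (n : ℕ) : Finset (G × ZMod p) :=
  {x | x.2 ≠ 0 ∧ residueAbs x.2 ≤ n ∧ residueAbs (((x.1 : (ZMod p)ˣ) : ZMod p) * x.2) ≤ n}

variable {G}

theorem mem_smallPairs {n : ℕ} {x : G × ZMod p} : x ∈ smallPairs G n ↔ x.2 ≠ 0 ∧
    residueAbs x.2 ≤ n ∧ residueAbs (((x.1 : (ZMod p)ˣ) : ZMod p) * x.2) ≤ n := by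
  simp [smallPairs]

/-- Up to signs, a pair `(g, a)` is a fraction `g = y / x` in lowest terms together with the common
factor `r` of `|g a|` and `|a|`. -/
theorem card_smallPairs_le (n : ℕ) :
    #(smallPairs G n) ≤ 4 * ∑ r ∈ Icc 1 n, #(fractionsIn (signClosure G) (n / r)) := by
  classical
  set S := (Icc 1 n).sigma fun r ↦ fractionsIn (signClosure G) (n / r) with hS
  have hScard : #((univ : Finset (Bool × Bool)) ×ˢ S) =
      4 * ∑ r ∈ Icc 1 n, #(fractionsIn (signClosure G) (n / r)) := by
    rw [card_product, card_sigma]; simp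
  rw [← hScard]
  set X : G × ZMod p → ℕ := fun x ↦ residueAbs x.2 with hX
  set Y : G × ZMod p → ℕ := fun x ↦ residueAbs (((x.1 : (ZMod p)ˣ) : ZMod p) * x.2) with hY
  refine card_le_card_of_injOn (fun x ↦ ((decide (x.2 = (X x : ZMod p)),
    decide (((x.1 : (ZMod p)ˣ) : ZMod p) * x.2 = (Y x : ZMod p))),
      ⟨(X x).gcd (Y x), (X x / (X x).gcd (Y x), Y x / (X x).gcd (Y x))⟩)) (fun x hx ↦ ?_)
        fun x hx y hy hxy ↦ ?_
  · obtain ⟨h1, h2, h3⟩ := mem_smallPairs.1 hx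
    have hX0 : 0 < X x := residueAbs_pos h1
    have hY0 : 0 < Y x := residueAbs_pos (mul_ne_zero (Units.ne_zero _) h1)
    have hr0 : 0 < (X x).gcd (Y x) := Nat.gcd_pos_of_pos_left _ hX0
    have hrX := Nat.gcd_dvd_left (X x) (Y x)
    have hrY := Nat.gcd_dvd_right (X x) (Y x)
    refine mem_product.2 ⟨mem_univ _, mem_sigma.2 ⟨mem_Icc.2 ⟨hr0, (Nat.le_of_dvd hX0 hrX).trans h2⟩,
      mem_fractionsIn.2 ⟨⟨⟨Nat.div_pos (Nat.le_of_dvd hX0 hrX) hr0, Nat.div_le_div_right h2⟩,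
        Nat.div_pos (Nat.le_of_dvd hY0 hrY) hr0, Nat.div_le_div_right h3⟩,
        Nat.coprime_div_gcd_div_gcd hr0, ?_⟩⟩⟩
    have hXne : (X x : ZMod p) ≠ 0 := by
      rcases eq_or_eq_neg_residueAbs x.2 with h | h
      · exact fun h0 ↦ h1 (h.trans h0)
      · exact fun h0 ↦ h1 (by rw [h]; exact neg_eq_zero.2 h0)
    obtain ⟨u, hu, huXY⟩ : ∃ u ∈ signClosure G, (Y x : ZMod p) = (u : ZMod p) * (X x : ZMod p) := by
      rcases eq_or_eq_neg_residueAbs x.2 with h | h <;>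
      rcases eq_or_eq_neg_residueAbs (((x.1 : (ZMod p)ˣ) : ZMod p) * x.2) with h' | h'
      · refine ⟨x.1, Or.inl x.1.2, ?_⟩
        simp only [hX, hY]
        rw [← h', ← h]
      · refine ⟨-x.1, Or.inr (by simp), ?_⟩
        simp only [hX, hY]
        rw [eq_neg_iff_add_eq_zero] at h'
        rw [← h]; push_cast; linear_combination h'
      · refine ⟨-x.1, Or.inr (by simp), ?_⟩
        simp only [hX, hY]
        rw [eq_neg_iff_add_eq_zero] at h
        push_cast; linear_combination -h' + (((x.1 : (ZMod p)ˣ) : ZMod p)) * h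
      · refine ⟨x.1, Or.inl x.1.2, ?_⟩
        simp only [hX, hY]
        rw [eq_neg_iff_add_eq_zero] at h h'
        linear_combination h' - (((x.1 : (ZMod p)ˣ) : ZMod p)) * h
    refine ⟨u, hu, ?_⟩
    obtain ⟨X', hX'⟩ := hrX
    obtain ⟨Y', hY'⟩ := hrY
    change ((Y x / (X x).gcd (Y x) : ℕ) : ZMod p) = u * ((X x / (X x).gcd (Y x) : ℕ) : ZMod p)
    generalize (X x).gcd (Y x) = r at *
    have e1 : X x / r = X' := by rw [hX', Nat.mul_div_cancel_left _ hr0]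
    have e2 : Y x / r = Y' := by rw [hY', Nat.mul_div_cancel_left _ hr0]
    rw [e1, e2]
    rw [hX', Nat.cast_mul] at hXne
    rw [hX', hY', Nat.cast_mul, Nat.cast_mul] at huXY
    refine mul_left_cancel₀ (left_ne_zero_of_mul hXne) ?_
    rw [huXY]; ring
  · obtain ⟨h1, -, -⟩ := mem_smallPairs.1 hx
    simp only [Prod.mk.injEq, Sigma.mk.injEq, decide_eq_decide] at hxy
    obtain ⟨⟨hs1, hs2⟩, hr, h⟩ := hxy
    have h := eq_of_heq h
    rw [Prod.mk.injEq, hr] at h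
    have eX : X x = X y := by
      refine (Nat.div_left_inj ?_ (Nat.gcd_dvd_left _ _)).1 h.1
      rw [← hr]; exact Nat.gcd_dvd_left _ _
    have eY : Y x = Y y := by
      refine (Nat.div_left_inj ?_ (Nat.gcd_dvd_right _ _)).1 h.2
      rw [← hr]; exact Nat.gcd_dvd_right _ _
    have recover : ∀ a b : ZMod p, residueAbs a = residueAbs b →
        (a = (residueAbs a : ZMod p) ↔ b = (residueAbs b : ZMod p)) → a = b := by
      intro a b hab hiff
      rcases eq_or_eq_neg_residueAbs a with ha | ha
      · rw [ha, hab]; exact (hiff.1 ha).symm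
      · rcases eq_or_eq_neg_residueAbs b with hb | hb
        · rw [hiff.2 hb, hab]; exact hb.symm
        · rw [ha, hb, hab]
    have e1 : x.2 = y.2 := recover _ _ eX hs1
    have e2 := recover _ _ eY hs2
    rw [← e1] at e2
    have e3 := Units.ext (mul_right_cancel₀ h1 e2)
    exact Prod.ext (Subtype.ext e3) e1

end SmallPairs

theorem sum_Icc_inv_le_log (n : ℕ) :
    ∑ r ∈ Icc 1 n, (r : ℝ)⁻¹ ≤ 1 + Real.log n := by
  have := harmonic_le_one_add_log n
  rw [harmonic_eq_sum_Icc] at this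
  push_cast at this
  exact this

/-- Summing the bound for fractions over the common factors gives the number of small pairs. -/
theorem exists_card_smallPairs_le {ν : ℕ} (hν : 1 ≤ ν) {ε : ℝ} (hε : 0 < ε) :
    ∃ C : ℝ, 0 < C ∧ ∀ (p : ℕ) [Fact p.Prime] (G : Subgroup (ZMod p)ˣ), p ≤ Nat.card G ^ 2 →
      ∀ n : ℕ, 1 ≤ n → (#(smallPairs G n) : ℝ) ≤ C * (p : ℝ) ^ ε *
        (((Nat.card G : ℝ) / p) ^ (1 / (ν : ℝ)) * (n : ℝ) ^ 2 +
          √((Nat.card G : ℝ) ^ (1 / (ν : ℝ)) * ((Nat.card G : ℝ) / p) ^ (1 / ((ν : ℝ) + 1))) * n) := by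
  obtain ⟨C, hC0, hC⟩ := exists_card_fractionsIn_le hν (half_pos hε)
  refine ⟨4 * C * (1 + 1 / (ε / 2)), by positivity, fun p _ G hpt n hn ↦ ?_⟩
  have hp1 : (1 : ℝ) < p := by exact_mod_cast (Fact.out : p.Prime).one_lt
  have hp0 : (0 : ℝ) < p := by linarith
  -- Residues have absolute value at most `p / 2`, so only `n ≤ p` matters.
  wlog hnp : n ≤ p generalizing n with H
  · have h1 : smallPairs G n ⊆ smallPairs G p := fun x hx ↦ by
      obtain ⟨h1, -⟩ := mem_smallPairs.1 hx
      exact mem_smallPairs.2 ⟨h1, (residueAbs_le _).trans (Nat.div_le_self _ _),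
        (residueAbs_le _).trans (Nat.div_le_self _ _)⟩
    have h2 := H p (Fact.out : p.Prime).one_lt.le le_rfl
    have h3 : (#(smallPairs G n) : ℝ) ≤ #(smallPairs G p) := by exact_mod_cast card_le_card h1
    refine h3.trans (h2.trans ?_)
    have : (p : ℝ) ≤ n := by exact_mod_cast (not_le.1 hnp).le
    gcongr
  have hC' := hC p G hpt
  set α := ((Nat.card G : ℝ) / p) ^ (1 / (ν : ℝ)) with hα
  set β := √((Nat.card G : ℝ) ^ (1 / (ν : ℝ)) * ((Nat.card G : ℝ) / p) ^ (1 / ((ν : ℝ) + 1)))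
    with hβ
  have hα0 : 0 ≤ α := by positivity
  have hβ0 : 0 ≤ β := by positivity
  have hn1 : (1 : ℝ) ≤ n := by exact_mod_cast hn
  have hterm : ∀ r ∈ Icc 1 n, (#(fractionsIn (signClosure G) (n / r)) : ℝ) ≤
      C * (p : ℝ) ^ (ε / 2) * (α * (n : ℝ) ^ 2 + β * n) * (r : ℝ)⁻¹ := by
    intro r hr
    obtain ⟨hr1, hrn⟩ := mem_Icc.1 hr
    have hr1' : (1 : ℝ) ≤ r := by exact_mod_cast hr1
    have hr0 : (0 : ℝ) < r := by linarith
    have h1 : ((n / r : ℕ) : ℝ) ≤ n * (r : ℝ)⁻¹ := by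
      rw [← div_eq_mul_inv]; exact Nat.cast_div_le
    refine (hC' (n / r) (Nat.div_pos hrn (by omega)) ((Nat.div_le_self _ _).trans hnp)).trans ?_
    rw [mul_assoc _ (α * (n : ℝ) ^ 2 + β * n)]
    refine mul_le_mul_of_nonneg_left ?_ (by positivity)
    have h2 : (r : ℝ)⁻¹ ^ 2 ≤ (r : ℝ)⁻¹ := by
      have := inv_le_one_of_one_le₀ hr1'
      have h0 : 0 ≤ (r : ℝ)⁻¹ := by positivity
      nlinarith
    calc α * ((n / r : ℕ) : ℝ) ^ 2 + β * ((n / r : ℕ) : ℝ)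
        ≤ α * (n * (r : ℝ)⁻¹) ^ 2 + β * (n * (r : ℝ)⁻¹) := by gcongr
      _ = α * (n : ℝ) ^ 2 * (r : ℝ)⁻¹ ^ 2 + β * n * (r : ℝ)⁻¹ := by ring
      _ ≤ α * (n : ℝ) ^ 2 * (r : ℝ)⁻¹ + β * n * (r : ℝ)⁻¹ := by gcongr
      _ = _ := by ring
  have hlog : 1 + Real.log n ≤ (1 + 1 / (ε / 2)) * (p : ℝ) ^ (ε / 2) := by
    have h1 : Real.log n ≤ Real.log p := Real.log_le_log (by linarith) (by exact_mod_cast hnp)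
    have h2 := Real.log_le_rpow_div hp0.le (half_pos hε)
    have h3 : 1 ≤ (p : ℝ) ^ (ε / 2) := Real.one_le_rpow hp1.le (half_pos hε).le
    calc 1 + Real.log n ≤ (p : ℝ) ^ (ε / 2) + (p : ℝ) ^ (ε / 2) / (ε / 2) := by linarith
      _ = _ := by ring
  have hpε : (p : ℝ) ^ ε = (p : ℝ) ^ (ε / 2) * (p : ℝ) ^ (ε / 2) := by
    rw [← Real.rpow_add hp0, add_halves]
  calc (#(smallPairs G n) : ℝ)
      ≤ 4 * ∑ r ∈ Icc 1 n, (#(fractionsIn (signClosure G) (n / r)) : ℝ) := by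
        exact_mod_cast card_smallPairs_le n
    _ ≤ 4 * ∑ r ∈ Icc 1 n, C * (p : ℝ) ^ (ε / 2) * (α * (n : ℝ) ^ 2 + β * n) * (r : ℝ)⁻¹ := by
        gcongr with r hr; exact hterm r hr
    _ ≤ 4 * (C * (p : ℝ) ^ (ε / 2) * (α * (n : ℝ) ^ 2 + β * n) *
          ((1 + 1 / (ε / 2)) * (p : ℝ) ^ (ε / 2))) := by
        rw [← mul_sum]
        gcongr
        exact (sum_Icc_inv_le_log n).trans hlog
    _ = _ := by rw [hpε]; ring

/-! ### Exponential sums over subgroups and intervals -/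

section ExpSum

variable {p : ℕ} [Fact p.Prime]

/-- The exponential sum `∑ i ∈ s, e(a f(i) / p)`. -/
noncomputable def expSum {ι : Type*} (s : Finset ι) (f : ι → ZMod p) (a : ZMod p) : ℂ :=
  ∑ i ∈ s, ZMod.stdAddChar (a * f i)

variable {ι : Type*} (s : Finset ι) (f : ι → ZMod p)

theorem expSum_zero : expSum s f 0 = #s := by simp [expSum]

theorem conj_expSum (a : ZMod p) : (starRingEnd ℂ) (expSum s f a) = expSum s f (-a) := by
  simp only [expSum, map_sum, ← AddChar.map_neg_eq_conj, neg_mul]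

theorem norm_expSum_neg (a : ZMod p) : ‖expSum s f (-a)‖ = ‖expSum s f a‖ := by
  rw [← conj_expSum, RCLike.norm_conj]

theorem expSum_mul {κ : Type*} (s' : Finset κ) (f' : κ → ZMod p) (a : ZMod p) :
    expSum s f a * expSum s' f' a = expSum (s ×ˢ s') (fun x ↦ f x.1 + f' x.2) a := by
  simp only [expSum, sum_mul_sum, sum_product, mul_add, AddChar.map_add_eq_mul]

theorem expSum_neg (a : ZMod p) : expSum s f (-a) = expSum s (fun i ↦ -f i) a := by
  simp [expSum]

theorem norm_expSum_sq (a : ZMod p) :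
    ‖expSum s f a‖ ^ 2 = ‖expSum (s ×ˢ s) (fun x ↦ f x.1 - f x.2) a‖ := by
  have h : ‖expSum s f a‖ ^ 2 = ‖expSum s f a‖ * ‖expSum s f (-a)‖ := by
    rw [norm_expSum_neg, sq]
  rw [h, ← norm_mul, expSum_neg, expSum_mul]
  simp only [sub_eq_add_neg]

theorem sum_expSum : ∑ a, expSum s f a = p * #{i ∈ s | f i = 0} := by
  simp only [expSum]
  rw [sum_comm]
  simp_rw [AddChar.sum_mulShift _ (ZMod.isPrimitive_stdAddChar p)]
  simp only [ZMod.card, Nat.cast_ite, Nat.cast_zero]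
  rw [← sum_filter, sum_const, nsmul_eq_mul, mul_comm]

/-- Parseval's identity. -/
theorem sum_norm_expSum_sq :
    ∑ a, ‖expSum s f a‖ ^ 2 = p * ∑ c, (#{i ∈ s | f i = c} : ℝ) ^ 2 := by
  have h1 : ∀ a, ((‖expSum s f a‖ ^ 2 : ℝ) : ℂ) =
      expSum (s ×ˢ s) (fun x ↦ f x.1 - f x.2) a := by
    intro a
    push_cast
    rw [← Complex.mul_conj', conj_expSum, expSum_neg, expSum_mul]
    simp only [sub_eq_add_neg]
  have h2 : ((∑ a, ‖expSum s f a‖ ^ 2 : ℝ) : ℂ) =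
      ((p * ∑ c, (#{i ∈ s | f i = c} : ℝ) ^ 2 : ℝ) : ℂ) := by
    rw [Complex.ofReal_sum]
    simp_rw [h1]
    rw [sum_expSum]
    push_cast
    congr 1
    have h3 : #{x ∈ s ×ˢ s | f x.1 - f x.2 = 0} = ∑ c, #{i ∈ s | f i = c} ^ 2 := by
      rw [card_eq_sum_card_fiberwise (f := fun x : ι × ι ↦ f x.1) (t := univ) (by simp)]
      refine sum_congr rfl fun c _ ↦ ?_
      rw [sq, ← card_product]
      congr 1
      ext x
      simp only [mem_filter, mem_product, sub_eq_zero]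
      constructor
      · rintro ⟨⟨⟨h1, h2⟩, h3⟩, h4⟩; exact ⟨⟨h1, h4⟩, h2, h3 ▸ h4⟩
      · rintro ⟨⟨h1, h2⟩, h3, h4⟩; exact ⟨⟨⟨h1, h3⟩, h2.trans h4.symm⟩, h2⟩
    rw [h3]; push_cast; rfl
  exact_mod_cast h2

theorem sum_norm_expSum_id_sq (T : Finset (ZMod p)) :
    ∑ a, ‖expSum T id a‖ ^ 2 = p * #T := by
  rw [sum_norm_expSum_sq, card_eq_sum_ones, Nat.cast_sum, ← sum_subset (subset_univ T)]
  · congr 1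
    refine sum_congr rfl fun c hc ↦ ?_
    have : ({i ∈ T | id i = c} : Finset (ZMod p)) = {c} := by
      ext i; simp only [mem_filter, id, mem_singleton]
      exact ⟨fun h ↦ h.2, fun h ↦ ⟨h ▸ hc, h⟩⟩
    rw [this]; simp
  · intro c _ hc
    have : ({i ∈ T | id i = c} : Finset (ZMod p)) = ∅ := by
      refine filter_eq_empty_iff.2 fun i hi h ↦ hc ?_
      exact h ▸ hi
    rw [this]; simp

theorem sum_units_eq_sum_erase {M : Type*} [AddCommMonoid M] (F : ZMod p → M) :
    ∑ a : (ZMod p)ˣ, F a = ∑ a ∈ univ.erase 0, F a := by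
  refine sum_bij (fun a _ ↦ (a : ZMod p)) (fun a _ ↦ ?_) (fun a _ b _ h ↦ Units.ext h)
    (fun b hb ↦ ?_) fun _ _ ↦ rfl
  · simp
  · exact ⟨Units.mk0 b (ne_of_mem_erase hb), mem_univ _, rfl⟩

theorem sum_units_le_sum {F : ZMod p → ℝ} (hF : ∀ a, 0 ≤ F a) :
    ∑ a : (ZMod p)ˣ, F a ≤ ∑ a, F a := by
  rw [sum_units_eq_sum_erase]
  exact sum_le_sum_of_subset_of_nonneg (erase_subset _ _) fun a _ _ ↦ hF a

section Subgroup

variable (G : Subgroup (ZMod p)ˣ)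

theorem expSum_residues_mul (g : G) (a : ZMod p) :
    expSum (residues G) id (((g : (ZMod p)ˣ) : ZMod p) * a) = expSum (residues G) id a := by
  refine sum_bij' (fun x _ ↦ ((g : (ZMod p)ˣ) : ZMod p) * x)
    (fun x _ ↦ (((g⁻¹ : G) : (ZMod p)ˣ) : ZMod p) * x) (fun x hx ↦ ?_) (fun x hx ↦ ?_)
    (fun x _ ↦ ?_) (fun x _ ↦ ?_) fun x _ ↦ ?_
  · obtain ⟨v, hv, rfl⟩ := mem_residues.1 hx
    exact mem_residues.2 ⟨g * v, mul_mem g.2 hv, Units.val_mul _ _⟩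
  · obtain ⟨v, hv, rfl⟩ := mem_residues.1 hx
    exact mem_residues.2 ⟨(g⁻¹ : G) * v, mul_mem (g⁻¹ : G).2 hv, Units.val_mul _ _⟩
  · rw [← mul_assoc, ← Units.val_mul, ← Subgroup.coe_mul, inv_mul_cancel, Subgroup.coe_one,
      Units.val_one, one_mul]
  · rw [← mul_assoc, ← Units.val_mul, ← Subgroup.coe_mul, mul_inv_cancel, Subgroup.coe_one,
      Units.val_one, one_mul]
  · simp only [id]; congr 1; ring

/-- The classical bound `√p` for exponential sums over subgroups. -/
theorem norm_expSum_residues_sq_le (a : (ZMod p)ˣ) : ‖expSum (residues G) id a‖ ^ 2 ≤ p := by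
  classical
  have ht : (0 : ℝ) < Nat.card G := by exact_mod_cast Nat.card_pos
  refine le_of_mul_le_mul_left ?_ ht
  calc (Nat.card G : ℝ) * ‖expSum (residues G) id (a : ZMod p)‖ ^ 2
      = ∑ g : G, ‖expSum (residues G) id ((((g : (ZMod p)ˣ) * a : (ZMod p)ˣ)) : ZMod p)‖ ^ 2 := by
        simp_rw [Units.val_mul, expSum_residues_mul]
        rw [sum_const, card_univ, nsmul_eq_mul, Nat.card_eq_fintype_card]
    _ = ∑ b ∈ univ.image fun g : G ↦ ((((g : (ZMod p)ˣ) * a : (ZMod p)ˣ)) : ZMod p),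
          ‖expSum (residues G) id b‖ ^ 2 := by
        rw [sum_image]
        intro g _ g' _ h
        exact Subtype.ext (mul_right_cancel (Units.ext h))
    _ ≤ ∑ b, ‖expSum (residues G) id b‖ ^ 2 := sum_le_univ_sum_of_nonneg fun _ ↦ by positivity
    _ = Nat.card G * p := by rw [sum_norm_expSum_id_sq, card_residues, mul_comm]

/-- The fourth moment of the exponential sums over a subgroup. For orders up to `p ^ (2 / 3)` this is
the energy bound, for larger orders the pointwise bound `√p` suffices. -/
theorem sum_norm_expSum_residues_pow_four_le :
    ∑ a : (ZMod p)ˣ, ‖expSum (residues G) id a‖ ^ 4 ≤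
      2500 * (p * ((Nat.card G : ℝ) ^ 2 * √(Nat.card G))) := by
  by_cases htp : 7 * Nat.card G ^ 3 ≤ p ^ 2
  · calc ∑ a : (ZMod p)ˣ, ‖expSum (residues G) id a‖ ^ 4
        ≤ ∑ a, ‖expSum (residues G) id a‖ ^ 4 := sum_units_le_sum
          (F := fun a ↦ ‖expSum (residues G) id a‖ ^ 4) fun _ ↦ by positivity
      _ = ∑ a, ‖expSum (residues G ×ˢ residues G) (fun x ↦ id x.1 - id x.2) a‖ ^ 2 := by
          refine sum_congr rfl fun a _ ↦ ?_
          rw [← norm_expSum_sq]; ring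
      _ = p * ∑ c, (diffCount G c : ℝ) ^ 2 := sum_norm_expSum_sq _ _
      _ ≤ p * (2500 * ((Nat.card G : ℝ) ^ 2 * √(Nat.card G))) := by
          gcongr; exact sum_diffCount_sq_le htp
      _ = _ := by ring
  · set t : ℝ := ((Nat.card G : ℕ) : ℝ) with ht
    have ht0 : 0 ≤ t := Nat.cast_nonneg _
    have hpt : (p : ℝ) ≤ 3 * (t * √t) := by
      have h1 : (p : ℝ) ^ 2 ≤ 7 * t ^ 3 := by rw [ht]; exact_mod_cast (not_le.1 htp).le
      refine le_of_pow_le_pow_left₀ (n := 2) (by norm_num) (by positivity) (h1.trans ?_)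
      rw [mul_pow, mul_pow, Real.sq_sqrt ht0]
      have : 0 ≤ t ^ 3 := by positivity
      nlinarith
    calc ∑ a : (ZMod p)ˣ, ‖expSum (residues G) id a‖ ^ 4
        ≤ ∑ a : (ZMod p)ˣ, p * ‖expSum (residues G) id (a : ZMod p)‖ ^ 2 := by
          refine sum_le_sum fun a _ ↦ ?_
          calc ‖expSum (residues G) id (a : ZMod p)‖ ^ 4
              = ‖expSum (residues G) id (a : ZMod p)‖ ^ 2 *
                ‖expSum (residues G) id (a : ZMod p)‖ ^ 2 := by ring
            _ ≤ _ := by gcongr; exact norm_expSum_residues_sq_le G a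
      _ ≤ p * ∑ a, ‖expSum (residues G) id a‖ ^ 2 := by
          rw [← mul_sum]
          gcongr
          exact sum_units_le_sum (F := fun a ↦ ‖expSum (residues G) id a‖ ^ 2) fun _ ↦ by positivity
      _ = p * (p * t) := by rw [sum_norm_expSum_id_sq, card_residues]
      _ ≤ p * (3 * (t * √t) * t) := by gcongr
      _ = 3 * (p * (t ^ 2 * √t)) := by ring
      _ ≤ _ := by gcongr; norm_num

end Subgroup

/-- The exponential sum over the interval `[0, M)`. -/
noncomputable def intervalSum (M : ℕ) (a : ZMod p) : ℂ :=
  expSum (range M) (fun x ↦ (x : ZMod p)) a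

theorem norm_intervalSum_le (M : ℕ) (a : ZMod p) : ‖intervalSum M a‖ ≤ M := by
  rw [intervalSum, expSum]
  refine (norm_sum_le _ _).trans ?_
  simp

theorem norm_stdAddChar_sub_one_ge (a : ZMod p) :
    4 * residueAbs a / p ≤ ‖(ZMod.stdAddChar a : ℂ) - 1‖ := by
  have hp0 : (0 : ℝ) < p := by exact_mod_cast (Fact.out : p.Prime).pos
  set k := a.valMinAbs with hk
  have hka : |(k : ℝ)| = residueAbs a := by
    rw [residueAbs, ← hk, Nat.cast_natAbs, Int.cast_abs]
  have hle : 2 * |(k : ℝ)| ≤ p := by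
    rw [hka]
    have := residueAbs_le a
    exact_mod_cast (by omega : 2 * residueAbs a ≤ p)
  have e : (ZMod.stdAddChar a : ℂ) = Complex.exp (Complex.I * ((2 * Real.pi * k / p : ℝ) : ℂ)) := by
    conv_lhs => rw [← ZMod.coe_valMinAbs a, ZMod.stdAddChar_coe]
    congr 1; push_cast; ring
  rw [e, Complex.norm_exp_I_mul_ofReal_sub_one, norm_mul, Real.norm_eq_abs, Real.norm_eq_abs,
    abs_of_pos (by norm_num : (0 : ℝ) < 2)]
  have harg : |2 * Real.pi * k / p / 2| ≤ Real.pi / 2 := by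
    rw [show 2 * Real.pi * k / p / 2 = Real.pi / p * k by field_simp, abs_mul,
      abs_of_pos (by positivity), div_mul_eq_mul_div, div_le_div_iff₀ hp0 (by norm_num)]
    nlinarith [Real.pi_pos]
  have h := Real.mul_abs_le_abs_sin harg
  have e2 : 2 / Real.pi * |2 * Real.pi * k / p / 2| = 2 * residueAbs a / p := by
    rw [show 2 * Real.pi * k / p / 2 = Real.pi / p * k by field_simp, abs_mul,
      abs_of_pos (by positivity), hka]
    field_simp
  rw [e2] at h
  calc 4 * (residueAbs a : ℝ) / p = 2 * (2 * residueAbs a / p) := by ring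
    _ ≤ _ := by gcongr

theorem norm_intervalSum_mul_residueAbs_le (M : ℕ) (a : ZMod p) :
    ‖intervalSum M a‖ * residueAbs a ≤ p := by
  have hp0 : (0 : ℝ) < p := by exact_mod_cast (Fact.out : p.Prime).pos
  set z : ℂ := ZMod.stdAddChar a with hz
  have hz1 : ‖z‖ = 1 := AddChar.norm_apply _ _
  have hgeom : intervalSum M a * (z - 1) = z ^ M - 1 := by
    rw [← geom_sum_mul z M, intervalSum, expSum]
    congr 1
    refine sum_congr rfl fun x _ ↦ ?_
    rw [hz, ← AddChar.map_nsmul_eq_pow, nsmul_eq_mul, mul_comm]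
  have h1 : ‖intervalSum M a‖ * ‖z - 1‖ ≤ 2 := by
    rw [← norm_mul, hgeom]
    refine (norm_sub_le _ _).trans ?_
    rw [norm_pow, hz1]; norm_num
  have h2 : ‖intervalSum M a‖ * (4 * residueAbs a / p) ≤ 2 :=
    (mul_le_mul_of_nonneg_left (norm_stdAddChar_sub_one_ge a) (norm_nonneg _)).trans h1
  have h3 : ‖intervalSum M a‖ * (4 * residueAbs a / p) * p =
      4 * (‖intervalSum M a‖ * residueAbs a) := by field_simp
  have h4 : ‖intervalSum M a‖ * (4 * residueAbs a / p) * p ≤ 2 * p := by gcongr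
  linarith

/-- Fourier expansion of the number of solutions of `v = u + x`, followed by Cauchy–Schwarz. -/
theorem card_sq_mul_le_of_forall_ne (G : Subgroup (ZMod p)ˣ) (M : ℕ) (U : Finset (ZMod p))
    (hU : ∀ u ∈ U, ∀ v ∈ G, ∀ x < M, (v : ZMod p) ≠ u + (x : ZMod p)) :
    (#U : ℝ) * ((Nat.card G : ℝ) * M) ^ 2 ≤
      p * ∑ a : (ZMod p)ˣ, ‖expSum (residues G) id a‖ ^ 2 * ‖intervalSum M (a : ZMod p)‖ ^ 2 := by
  set T := ∑ a : (ZMod p)ˣ, ‖expSum (residues G) id a‖ ^ 2 * ‖intervalSum M (a : ZMod p)‖ ^ 2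
    with hT
  have hzero : ∑ a, expSum U id a * intervalSum M a * expSum (residues G) id (-a) = 0 := by
    simp_rw [intervalSum, expSum_neg, expSum_mul]
    rw [sum_expSum, filter_eq_empty_iff.2]
    · simp
    · rintro ⟨⟨u, x⟩, v⟩ hx h
      simp only [mem_product, mem_range] at hx
      obtain ⟨⟨hu, hxM⟩, hv⟩ := hx
      obtain ⟨v', hv', rfl⟩ := mem_residues.1 hv
      refine hU u hu v' hv' x hxM ?_
      simp only [id] at h
      linear_combination -h
  rw [← add_sum_erase univ _ (mem_univ 0), ← sum_units_eq_sum_erase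
    (fun a ↦ expSum U id a * intervalSum M a * expSum (residues G) id (-a)), intervalSum,
    expSum_zero, expSum_zero, neg_zero, expSum_zero, card_range, card_residues,
    add_eq_zero_iff_eq_neg] at hzero
  have h1 : (#U : ℝ) * (Nat.card G * M) ≤ ∑ a : (ZMod p)ˣ, ‖expSum U id (a : ZMod p)‖ *
      (‖expSum (residues G) id (a : ZMod p)‖ * ‖intervalSum M (a : ZMod p)‖) := by
    have h2 := congrArg norm hzero
    rw [norm_neg] at h2
    have h3 : ‖((#U : ℂ) * M * Nat.card G)‖ = (#U : ℝ) * (Nat.card G * M) := by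
      simp only [norm_mul, Complex.norm_natCast]; ring
    rw [← h3, h2]
    refine (norm_sum_le _ _).trans (le_of_eq (sum_congr rfl fun a _ ↦ ?_))
    rw [norm_mul, norm_mul, norm_expSum_neg]; ring
  have h4 : ((#U : ℝ) * (Nat.card G * M)) ^ 2 ≤ (p * #U) * T := by
    calc ((#U : ℝ) * (Nat.card G * M)) ^ 2
        ≤ (∑ a : (ZMod p)ˣ, ‖expSum U id (a : ZMod p)‖ *
          (‖expSum (residues G) id (a : ZMod p)‖ * ‖intervalSum M (a : ZMod p)‖)) ^ 2 := by gcongr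
      _ ≤ (∑ a : (ZMod p)ˣ, ‖expSum U id (a : ZMod p)‖ ^ 2) * ∑ a : (ZMod p)ˣ,
          (‖expSum (residues G) id (a : ZMod p)‖ * ‖intervalSum M (a : ZMod p)‖) ^ 2 :=
          sum_mul_sq_le_sq_mul_sq _ _ _
      _ ≤ (p * #U) * T := by
          simp_rw [mul_pow]
          rw [← sum_norm_expSum_id_sq U]
          gcongr
          exact sum_units_le_sum (F := fun a ↦ ‖expSum U id a‖ ^ 2) fun _ ↦ by positivity
  rcases Nat.eq_zero_or_pos #U with h0 | h0
  · rw [h0]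
    simp only [Nat.cast_zero, zero_mul]
    positivity
  · have hU0 : (0 : ℝ) < #U := by exact_mod_cast h0
    refine le_of_mul_le_mul_left ?_ hU0
    linarith

/-- The sum `∑ |S(a)| ^ 2 w(a)` is averaged over the cosets of `G`, on which `S` is constant. -/
theorem card_mul_sum_sq_le (G : Subgroup (ZMod p)ˣ) [Fintype G] (w : ZMod p → ℝ) :
    (Nat.card G : ℝ) * (∑ a : (ZMod p)ˣ, ‖expSum (residues G) id a‖ ^ 2 * w a) ^ 2 ≤
      (∑ a : (ZMod p)ˣ, ‖expSum (residues G) id a‖ ^ 4) *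
        ∑ g : G, ∑ a : (ZMod p)ˣ, w a * w (((g : (ZMod p)ˣ) : ZMod p) * a) := by
  set T := ∑ a : (ZMod p)ˣ, ‖expSum (residues G) id a‖ ^ 2 * w a with hT
  set K := ∑ g : G, ∑ a : (ZMod p)ˣ, w a * w (((g : (ZMod p)ˣ) : ZMod p) * a) with hK
  have ht0 : (0 : ℝ) < Nat.card G := by exact_mod_cast Nat.card_pos
  have h1 : (Nat.card G : ℝ) * T = ∑ a : (ZMod p)ˣ, ‖expSum (residues G) id (a : ZMod p)‖ ^ 2 *
      ∑ g : G, w (((g : (ZMod p)ˣ) : ZMod p) * a) := by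
    simp_rw [mul_sum]
    rw [sum_comm]
    have : ∀ g : G, ∑ a : (ZMod p)ˣ, ‖expSum (residues G) id (a : ZMod p)‖ ^ 2 *
        w (((g : (ZMod p)ˣ) : ZMod p) * a) = T := by
      intro g
      rw [hT, ← Equiv.sum_comp (Equiv.mulLeft (g : (ZMod p)ˣ))
        (fun a : (ZMod p)ˣ ↦ ‖expSum (residues G) id (a : ZMod p)‖ ^ 2 * w a)]
      refine sum_congr rfl fun a _ ↦ ?_
      rw [Equiv.coe_mulLeft, Units.val_mul, expSum_residues_mul]
    simp_rw [this]
    rw [sum_const, card_univ, nsmul_eq_mul, Nat.card_eq_fintype_card]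
  have h2 : ∑ a : (ZMod p)ˣ, (∑ g : G, w (((g : (ZMod p)ˣ) : ZMod p) * a)) ^ 2 =
      Nat.card G * K := by
    simp_rw [sq, sum_mul_sum]
    rw [sum_comm]
    have : ∀ g : G, ∑ a : (ZMod p)ˣ, ∑ g' : G, w (((g : (ZMod p)ˣ) : ZMod p) * a) *
        w (((g' : (ZMod p)ˣ) : ZMod p) * a) = K := by
      intro g
      rw [sum_comm, hK, ← Equiv.sum_comp (Equiv.mulRight g) (fun g' : G ↦ ∑ a : (ZMod p)ˣ,
        w (((g : (ZMod p)ˣ) : ZMod p) * a) * w (((g' : (ZMod p)ˣ) : ZMod p) * a))]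
      refine sum_congr rfl fun h _ ↦ ?_
      rw [← Equiv.sum_comp (Equiv.mulLeft (g : (ZMod p)ˣ)) (fun a : (ZMod p)ˣ ↦
        w a * w (((h : (ZMod p)ˣ) : ZMod p) * a))]
      simp only [Equiv.coe_mulLeft, Equiv.coe_mulRight, Units.val_mul, Subgroup.coe_mul, mul_assoc]
    simp_rw [this]
    rw [sum_const, card_univ, nsmul_eq_mul, Nat.card_eq_fintype_card]
  have h3 : ((Nat.card G : ℝ) * T) ^ 2 ≤
      (∑ a : (ZMod p)ˣ, ‖expSum (residues G) id (a : ZMod p)‖ ^ 4) * (Nat.card G * K) := by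
    rw [h1, ← h2]
    refine (sum_mul_sq_le_sq_mul_sq _ _ _).trans (le_of_eq ?_)
    simp_rw [← pow_mul]
  refine le_of_mul_le_mul_left ?_ ht0
  linarith

end ExpSum

/-! ### The correlation of the interval sum -/

/-- The correlation of `|D| ^ 2` along `G`, where `D` is the exponential sum over `[0, M)`: since
`|D(a)| ≤ min(M, p / |a|)`, the pairs with `max(|a|, |g a|)` of size about `2 ^ j` contribute at most
the number of small pairs at level `2 ^ j` times `M ^ 4 * min(1, (p / (M * 2 ^ j)) ^ 2)`. -/
theorem sum_norm_intervalSum_sq_mul_sq_le {p : ℕ} [Fact p.Prime] (G : Subgroup (ZMod p)ˣ) [Fintype G] {M : ℕ}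
    (hM : 1 ≤ M) {α β : ℝ} (hα : 0 ≤ α) (hβ : 0 ≤ β)
    (hN : ∀ n : ℕ, 1 ≤ n → (#(smallPairs G n) : ℝ) ≤ α * (n : ℝ) ^ 2 + β * n) :
    ∑ g : G, ∑ a : (ZMod p)ˣ, ‖intervalSum M (a : ZMod p)‖ ^ 2 *
        ‖intervalSum M (((g : (ZMod p)ˣ) : ZMod p) * (a : ZMod p))‖ ^ 2 ≤
      4 * (Nat.log 2 p + 1) * (M : ℝ) ^ 4 * (α * ((p : ℝ) / M) ^ 2 + β * ((p : ℝ) / M)) := by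
  classical
  have hp0 : (0 : ℝ) < p := by exact_mod_cast (Fact.out : p.Prime).pos
  have hM0 : (0 : ℝ) < M := by exact_mod_cast hM
  set h : ℝ := (p : ℝ) / M with hh
  have hh0 : 0 < h := by positivity
  set mx : G × (ZMod p)ˣ → ℕ := fun x ↦
    max (residueAbs (x.2 : ZMod p)) (residueAbs (((x.1 : (ZMod p)ˣ) : ZMod p) * (x.2 : ZMod p))) with hmx
  have hmx0 : ∀ x, 0 < mx x := fun x ↦ lt_max_of_lt_left (residueAbs_pos x.2.ne_zero)
  have hmxp : ∀ x, mx x ≤ p := fun x ↦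
    (max_le (residueAbs_le _) (residueAbs_le _)).trans (Nat.div_le_self _ _)
  have hDM : ∀ a : ZMod p, ‖intervalSum M a‖ ^ 2 ≤ (M : ℝ) ^ 2 := fun a ↦ by
    gcongr; exact norm_intervalSum_le M a
  have hDa : ∀ a : ZMod p, ∀ y : ℝ, 0 < y → y ≤ residueAbs a →
      ‖intervalSum M a‖ ^ 2 ≤ (M : ℝ) ^ 2 * (h / y) ^ 2 := by
    intro a y hy hya
    rw [← mul_pow]
    gcongr
    have h1 : ‖intervalSum M a‖ * y ≤ p :=
      (mul_le_mul_of_nonneg_left hya (norm_nonneg _)).trans (norm_intervalSum_mul_residueAbs_le M a)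
    rw [hh]
    rw [show (M : ℝ) * (p / M / y) = p / y by field_simp, le_div_iff₀ hy]
    exact h1
  have hterm : ∀ x : G × (ZMod p)ˣ, ∀ y : ℝ, 0 < y → y ≤ mx x →
      ‖intervalSum M (x.2 : ZMod p)‖ ^ 2 *
        ‖intervalSum M (((x.1 : (ZMod p)ˣ) : ZMod p) * (x.2 : ZMod p))‖ ^ 2 ≤
      (M : ℝ) ^ 4 * min 1 ((h / y) ^ 2) := by
    intro x y hy hyx
    rw [mul_min_of_nonneg _ _ (by positivity), mul_one]
    refine le_min ?_ ?_
    · calc _ ≤ (M : ℝ) ^ 2 * (M : ℝ) ^ 2 :=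
            mul_le_mul (hDM _) (hDM _) (by positivity) (by positivity)
        _ = (M : ℝ) ^ 4 := by ring
    · rcases le_max_iff.1 (show y ≤ max (residueAbs (x.2 : ZMod p) : ℝ)
        (residueAbs (((x.1 : (ZMod p)ˣ) : ZMod p) * (x.2 : ZMod p)) : ℝ) by
          simpa [hmx] using hyx) with hle | hle
      · calc _ ≤ ((M : ℝ) ^ 2 * (h / y) ^ 2) * (M : ℝ) ^ 2 :=
              mul_le_mul (hDa _ y hy hle) (hDM _) (by positivity) (by positivity)
          _ = _ := by ring
      · calc _ ≤ (M : ℝ) ^ 2 * ((M : ℝ) ^ 2 * (h / y) ^ 2) :=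
              mul_le_mul (hDM _) (hDa _ y hy hle) (by positivity) (by positivity)
          _ = _ := by ring
  have hweight : ∀ y : ℝ, 0 < y → min 1 ((h / y) ^ 2) * (α * y ^ 2 + β * y) ≤ α * h ^ 2 + β * h := by
    intro y hy
    have hmin0 : 0 ≤ min 1 ((h / y) ^ 2) := le_min zero_le_one (by positivity)
    rcases le_total y h with hyh | hyh
    · calc _ ≤ 1 * (α * y ^ 2 + β * y) := by gcongr; exact min_le_left _ _
        _ ≤ _ := by rw [one_mul]; gcongr
    · calc _ ≤ (h / y) ^ 2 * (α * y ^ 2 + β * y) := by gcongr; exact min_le_right _ _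
        _ = α * h ^ 2 + β * h * (h / y) := by field_simp
        _ ≤ α * h ^ 2 + β * h * 1 := by gcongr; exact (div_le_one hy).2 hyh
        _ = _ := by ring
  rw [← Fintype.sum_prod_type' (f := fun (g : G) (a : (ZMod p)ˣ) ↦ ‖intervalSum M (a : ZMod p)‖ ^ 2 *
    ‖intervalSum M (((g : (ZMod p)ˣ) : ZMod p) * (a : ZMod p))‖ ^ 2)]
  rw [← sum_fiberwise_of_maps_to (s := univ) (t := range (Nat.log 2 p + 1))
    (g := fun x : G × (ZMod p)ˣ ↦ Nat.log 2 (mx x))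
    (fun x _ ↦ mem_range.2 (Nat.lt_succ_of_le (Nat.log_mono_right (hmxp x))))]
  have hfiber : ∀ j ∈ range (Nat.log 2 p + 1),
      ∑ x : G × (ZMod p)ˣ with Nat.log 2 (mx x) = j, ‖intervalSum M (x.2 : ZMod p)‖ ^ 2 *
        ‖intervalSum M (((x.1 : (ZMod p)ˣ) : ZMod p) * (x.2 : ZMod p))‖ ^ 2 ≤
      4 * (M : ℝ) ^ 4 * (α * h ^ 2 + β * h) := by
    intro j _
    set y : ℝ := (2 : ℝ) ^ j with hy
    have hy0 : 0 < y := by positivity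
    have hmin0 : 0 ≤ min 1 ((h / y) ^ 2) := le_min zero_le_one (by positivity)
    have hcard : (#{x : G × (ZMod p)ˣ | Nat.log 2 (mx x) = j} : ℝ) ≤ 4 * (α * y ^ 2 + β * y) := by
      have h1 : #{x : G × (ZMod p)ˣ | Nat.log 2 (mx x) = j} ≤ #(smallPairs G (2 ^ (j + 1))) := by
        refine card_le_card_of_injOn (fun x ↦ (x.1, (x.2 : ZMod p))) (fun x hx ↦ ?_)
          fun x _ y _ hxy ↦ ?_
        · have hlog := (mem_filter.1 hx).2
          have hlt : mx x < 2 ^ (j + 1) := by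
            rw [← hlog]; exact Nat.lt_pow_succ_log_self (by norm_num) _
          exact mem_smallPairs.2 ⟨x.2.ne_zero, (le_max_left _ _).trans hlt.le,
            (le_max_right _ _).trans hlt.le⟩
        · simp only [Prod.mk.injEq] at hxy
          exact Prod.ext hxy.1 (Units.ext hxy.2)
      have h2 := hN (2 ^ (j + 1)) Nat.one_le_two_pow
      have h3 : (#{x : G × (ZMod p)ˣ | Nat.log 2 (mx x) = j} : ℝ) ≤ #(smallPairs G (2 ^ (j + 1))) := by
        exact_mod_cast h1
      refine h3.trans (h2.trans ?_)
      push_cast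
      rw [pow_succ (2 : ℝ) j, ← hy]
      have : 0 ≤ β * y := by positivity
      nlinarith
    calc _ ≤ ∑ x : G × (ZMod p)ˣ with Nat.log 2 (mx x) = j, (M : ℝ) ^ 4 * min 1 ((h / y) ^ 2) := by
          refine sum_le_sum fun x hx ↦ hterm x y hy0 ?_
          have hlog := (mem_filter.1 hx).2
          rw [hy, ← hlog]
          exact_mod_cast Nat.pow_log_le_self 2 (hmx0 x).ne'
      _ = #{x : G × (ZMod p)ˣ | Nat.log 2 (mx x) = j} * ((M : ℝ) ^ 4 * min 1 ((h / y) ^ 2)) := by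
          rw [sum_const, nsmul_eq_mul]
      _ ≤ 4 * (α * y ^ 2 + β * y) * ((M : ℝ) ^ 4 * min 1 ((h / y) ^ 2)) := by gcongr
      _ = 4 * (M : ℝ) ^ 4 * (min 1 ((h / y) ^ 2) * (α * y ^ 2 + β * y)) := by ring
      _ ≤ _ := by gcongr; exact hweight y hy0
  refine (sum_le_sum hfiber).trans (le_of_eq ?_)
  rw [sum_const, card_range, nsmul_eq_mul]
  push_cast
  ring

theorem natLog_add_one_le_rpow {ε : ℝ} (hε : 0 < ε) {p : ℕ} (hp : 1 ≤ p) :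
    (Nat.log 2 p : ℝ) + 1 ≤ (2 / ε + 1) * (p : ℝ) ^ ε := by
  have hp1 : (1 : ℝ) ≤ p := by exact_mod_cast hp
  have h1 : (Nat.log 2 p : ℝ) * Real.log 2 ≤ Real.log p := by
    rw [← Real.log_pow]
    exact Real.log_le_log (by positivity) (by exact_mod_cast Nat.pow_log_le_self 2 (by omega))
  have h2 := Real.log_le_rpow_div (by linarith : (0 : ℝ) ≤ p) hε
  have h3 : 1 ≤ (p : ℝ) ^ ε := Real.one_le_rpow hp1 hε.le
  have h4 := Real.log_two_gt_d9
  have h5 : (Nat.log 2 p : ℝ) * (1 / 2) ≤ (Nat.log 2 p : ℝ) * Real.log 2 := by gcongr; linarith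
  calc (Nat.log 2 p : ℝ) + 1 ≤ 2 * ((p : ℝ) ^ ε / ε) + (p : ℝ) ^ ε := by linarith
    _ = _ := by ring

/-- The bound for the avoiding set with an explicit `p ^ ε`, squared to keep the exponents simple. -/
theorem exists_ncard_avoidingSet_sq_le {ν : ℕ} (hν : 1 ≤ ν) {ε : ℝ} (hε : 0 < ε) :
    ∃ C : ℝ, 0 < C ∧ ∀ (p : ℕ) [Fact p.Prime] (G : Subgroup (ZMod p)ˣ), p ≤ Nat.card G ^ 2 →
      ∀ H : ℝ, 0 < H → ((avoidingSet p G H).ncard : ℝ) ^ 2 * ((Nat.card G : ℝ) ^ 2 * √(Nat.card G)) ≤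
        C * (p : ℝ) ^ ε * (p : ℝ) ^ 3 *
        (((Nat.card G : ℝ) / p) ^ (1 / (ν : ℝ)) * ((p : ℝ) / H) ^ 2 +
          √((Nat.card G : ℝ) ^ (1 / (ν : ℝ)) * ((Nat.card G : ℝ) / p) ^ (1 / ((ν : ℝ) + 1))) *
            ((p : ℝ) / H)) := by
  obtain ⟨C, hC0, hC⟩ := exists_card_smallPairs_le hν (half_pos hε)
  refine ⟨2500 * (4 * (2 / (ε / 2) + 1)) * C, by positivity, fun p _ G hpt H hH ↦ ?_⟩
  classical
  have hp1 : (1 : ℝ) < p := by exact_mod_cast (Fact.out : p.Prime).one_lt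
  have hp0 : (0 : ℝ) < p := by linarith
  have hN := hC p G hpt
  set α := ((Nat.card G : ℝ) / p) ^ (1 / (ν : ℝ)) with hα
  set β := √((Nat.card G : ℝ) ^ (1 / (ν : ℝ)) * ((Nat.card G : ℝ) / p) ^ (1 / ((ν : ℝ) + 1)))
    with hβ
  have hα0 : 0 ≤ α := by positivity
  have hβ0 : 0 ≤ β := by positivity
  set M := ⌈H⌉₊ with hM
  have hM1 : 1 ≤ M := Nat.one_le_ceil_iff.2 hH
  have hM0 : (0 : ℝ) < M := by exact_mod_cast hM1
  have hHM : H ≤ M := Nat.le_ceil H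
  set U : Finset (ZMod p) := (avoidingSet p G H).toFinite.toFinset with hU
  have hUcard : (avoidingSet p G H).ncard = #U := Set.ncard_eq_toFinset_card _ _
  rw [hUcard]
  have havoid : ∀ u ∈ U, ∀ v ∈ G, ∀ x < M, (v : ZMod p) ≠ u + (x : ZMod p) := by
    intro u hu v hv x hx heq
    refine ((Set.Finite.mem_toFinset _).1 hu) ⟨v, hv, x, Int.natCast_nonneg x, ?_, ?_⟩
    · exact_mod_cast Nat.lt_ceil.1 hx
    · rw [heq]; simp
  have h1 := card_sq_mul_le_of_forall_ne G M U havoid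
  have h2 := card_mul_sum_sq_le G (fun a ↦ ‖intervalSum M a‖ ^ 2)
  have h3 := sum_norm_expSum_residues_pow_four_le G
  have h4 := sum_norm_intervalSum_sq_mul_sq_le G hM1 (α := C * (p : ℝ) ^ (ε / 2) * α)
    (β := C * (p : ℝ) ^ (ε / 2) * β) (by positivity) (by positivity)
    (fun n hn ↦ (hN n hn).trans (le_of_eq (by ring)))
  set T := ∑ a : (ZMod p)ˣ, ‖expSum (residues G) id a‖ ^ 2 * ‖intervalSum M (a : ZMod p)‖ ^ 2
  set K := ∑ g : G, ∑ a : (ZMod p)ˣ, ‖intervalSum M (a : ZMod p)‖ ^ 2 *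
        ‖intervalSum M (((g : (ZMod p)ˣ) : ZMod p) * (a : ZMod p))‖ ^ 2
  set E := ∑ a : (ZMod p)ˣ, ‖expSum (residues G) id (a : ZMod p)‖ ^ 4
  have h5 := natLog_add_one_le_rpow (half_pos hε) (Fact.out : p.Prime).one_lt.le
  have ht0 : (0 : ℝ) < Nat.card G := by exact_mod_cast Nat.card_pos
  set t : ℝ := ((Nat.card G : ℕ) : ℝ) with ht
  set s := √t with hs
  have hs0 : 0 < s := Real.sqrt_pos.2 ht0
  have hss : s ^ 2 = t := Real.sq_sqrt ht0.le
  have hT0 : 0 ≤ T := sum_nonneg fun _ _ ↦ by positivity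
  have hK0 : 0 ≤ K := sum_nonneg fun _ _ ↦ sum_nonneg fun _ _ ↦ by positivity
  have hpε : (p : ℝ) ^ ε = (p : ℝ) ^ (ε / 2) * (p : ℝ) ^ (ε / 2) := by
    rw [← Real.rpow_add hp0, add_halves]
  have hKbound : K ≤ 4 * (2 / (ε / 2) + 1) * C * (p : ℝ) ^ ε * (M : ℝ) ^ 4 *
      (α * ((p : ℝ) / H) ^ 2 + β * ((p : ℝ) / H)) := by
    refine h4.trans ?_
    calc _ ≤ 4 * ((2 / (ε / 2) + 1) * (p : ℝ) ^ (ε / 2)) * (M : ℝ) ^ 4 *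
          (C * (p : ℝ) ^ (ε / 2) * α * ((p : ℝ) / H) ^ 2 +
            C * (p : ℝ) ^ (ε / 2) * β * ((p : ℝ) / H)) := by gcongr
      _ = _ := by rw [hpε]; ring
  have hmain : (#U : ℝ) ^ 2 * (t * M) ^ 4 * t ≤ p ^ 2 * (2500 * (p * (t ^ 2 * s)) * K) := by
    calc (#U : ℝ) ^ 2 * (t * M) ^ 4 * t = ((#U : ℝ) * (t * M) ^ 2) ^ 2 * t := by ring
      _ ≤ (p * T) ^ 2 * t := by gcongr
      _ = p ^ 2 * (t * T ^ 2) := by ring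
      _ ≤ p ^ 2 * (E * K) := by gcongr
      _ ≤ _ := by gcongr
  have hfac : 0 < (M : ℝ) ^ 4 * (t ^ 2 * s) := by positivity
  refine le_of_mul_le_mul_right ?_ hfac
  calc (#U : ℝ) ^ 2 * (t ^ 2 * s) * ((M : ℝ) ^ 4 * (t ^ 2 * s))
      = (#U : ℝ) ^ 2 * (t * M) ^ 4 * t := by
        rw [show (#U : ℝ) ^ 2 * (t ^ 2 * s) * ((M : ℝ) ^ 4 * (t ^ 2 * s)) =
          (#U : ℝ) ^ 2 * (t * M) ^ 4 * s ^ 2 by ring, hss]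
    _ ≤ _ := hmain
    _ ≤ p ^ 2 * (2500 * (p * (t ^ 2 * s)) * (4 * (2 / (ε / 2) + 1) * C * (p : ℝ) ^ ε * (M : ℝ) ^ 4 *
      (α * ((p : ℝ) / H) ^ 2 + β * ((p : ℝ) / H)))) := by gcongr
    _ = _ := by ring

/-! ### The final estimate -/

/-- A family of bounds `c k * p ^ (1 / (k + 1))` with constants `c k` amounts to a single bound
`p ^ o(1)`. -/
theorem exists_tendsto_zero_mul_rpow_le {c : ℕ → ℝ} (hc : ∀ k, 1 ≤ c k) :
    ∃ δ : ℕ → ℝ, Tendsto δ atTop (𝓝 0) ∧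
      ∀ p : ℕ, 2 ≤ p → ∃ k : ℕ, c k * (p : ℝ) ^ (1 / ((k : ℝ) + 1)) ≤ (p : ℝ) ^ δ p := by
  set e : ℕ → ℕ → ℝ := fun p k ↦ 1 / ((k : ℝ) + 1) + Real.log (c k) / Real.log p with he
  have he0 : ∀ p k, 0 ≤ e p k := fun p k ↦
    add_nonneg (by positivity) (div_nonneg (Real.log_nonneg (hc k)) (Real.log_natCast_nonneg p))
  have hbdd : ∀ p, BddBelow (Set.range (e p)) := fun p ↦ ⟨0, by rintro _ ⟨k, rfl⟩; exact he0 p k⟩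
  -- The summand `1 / (p + 1)` makes the infimum strictly smaller than `δ p`.
  refine ⟨fun p ↦ (⨅ k, e p k) + 1 / ((p : ℝ) + 1), ?_, fun p hp ↦ ?_⟩
  · have h2 : Tendsto (fun p : ℕ ↦ 1 / ((p : ℝ) + 1)) atTop (𝓝 0) :=
      tendsto_one_div_add_atTop_nhds_zero_nat
    have h1 : Tendsto (fun p : ℕ ↦ ⨅ k, e p k) atTop (𝓝 0) := by
      rw [Metric.tendsto_atTop']
      intro η hη
      obtain ⟨k, hk⟩ := exists_nat_one_div_lt (half_pos hη)
      have h3 : Tendsto (fun p : ℕ ↦ Real.log (c k) / Real.log p) atTop (𝓝 0) :=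
        (Real.tendsto_log_atTop.comp tendsto_natCast_atTop_atTop).const_div_atTop _
      obtain ⟨N, hN⟩ := eventually_atTop.1 (h3.eventually (gt_mem_nhds (half_pos hη)))
      refine ⟨N, fun p hp ↦ ?_⟩
      rw [Real.dist_eq, sub_zero, abs_of_nonneg (le_ciInf (he0 p))]
      have h4 := hN p hp.le
      calc ⨅ k, e p k ≤ e p k := ciInf_le (hbdd p) k
        _ < η := by simp only [he]; linarith
    simpa using h1.add h2
  · have hp1 : (1 : ℝ) < p := by exact_mod_cast hp
    have hp0 : (0 : ℝ) < p := by linarith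
    have hlog : 0 < Real.log p := Real.log_pos hp1
    obtain ⟨k, hk⟩ := exists_lt_of_ciInf_lt
      (show ⨅ k, e p k < (⨅ k, e p k) + 1 / ((p : ℝ) + 1) from
        lt_add_of_pos_right _ (by positivity))
    refine ⟨k, le_trans (le_of_eq ?_) (Real.rpow_le_rpow_of_exponent_le hp1.le hk.le)⟩
    have hck : 0 < c k := by linarith [hc k]
    simp only [he]
    rw [Real.rpow_add hp0, mul_comm]
    congr 1
    rw [Real.rpow_def_of_pos hp0, mul_div_cancel₀ _ hlog.ne', Real.exp_log hck]

section Exponents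

variable {p t H ν : ℝ}

theorem first_term_sq (hp : 0 < p) (ht : 0 < t) (hH : 0 < H) (hν : 0 < ν) :
    (p ^ (2 - 1 / (4 * (ν + 1))) * H ^ (-(1 / 2) : ℝ) *
      t ^ (-(5 / 4) + (2 * ν + 1) / (4 * ν * (ν + 1)))) ^ 2 * (t ^ 2 * √t) =
    p ^ 3 * (√(t ^ (1 / ν) * (t / p) ^ (1 / (ν + 1))) * (p / H)) := by
  have hν1 : ν + 1 ≠ 0 := by positivity
  obtain ⟨P, rfl⟩ : ∃ P, p = Real.exp P := ⟨_, (Real.exp_log hp).symm⟩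
  obtain ⟨T, rfl⟩ : ∃ T, t = Real.exp T := ⟨_, (Real.exp_log ht).symm⟩
  obtain ⟨h, rfl⟩ : ∃ h, H = Real.exp h := ⟨_, (Real.exp_log hH).symm⟩
  simp only [← Real.exp_sub, ← Real.exp_mul, ← Real.exp_add, ← Real.exp_half, ← Real.exp_nat_mul]
  congr 1
  push_cast
  field_simp
  ring

theorem second_term_sq (hp : 0 < p) (ht : 0 < t) (hH : 0 < H) (hν : 0 < ν) :
    (p ^ (5 / 2 - 1 / (2 * ν)) * H ^ (-1 : ℝ) * t ^ (-(5 / 4) + 1 / (2 * ν))) ^ 2 * (t ^ 2 * √t) =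
    p ^ 3 * ((t / p) ^ (1 / ν) * (p / H) ^ 2) := by
  obtain ⟨P, rfl⟩ : ∃ P, p = Real.exp P := ⟨_, (Real.exp_log hp).symm⟩
  obtain ⟨T, rfl⟩ : ∃ T, t = Real.exp T := ⟨_, (Real.exp_log ht).symm⟩
  obtain ⟨h, rfl⟩ : ∃ h, H = Real.exp h := ⟨_, (Real.exp_log hH).symm⟩
  simp only [← Real.exp_sub, ← Real.exp_mul, ← Real.exp_add, ← Real.exp_half, ← Real.exp_nat_mul]
  congr 1
  push_cast
  field_simp
  ring

end Exponents

theorem exists_ncard_avoidingSet_le {ν : ℕ} (hν : 1 ≤ ν) {ε : ℝ} (hε : 0 < ε) :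
    ∃ C : ℝ, 1 ≤ C ∧ ∀ p : ℕ, p.Prime →
      ∀ G : Subgroup (ZMod p)ˣ, (p : ℝ) ^ (1 / 2 : ℝ) < (Nat.card G : ℝ) →
      ∀ H : ℝ, 0 < H → ((avoidingSet p G H).ncard : ℝ) ≤ C * (p : ℝ) ^ ε *
        ((p : ℝ) ^ (2 - 1 / (4 * ((ν : ℝ) + 1))) * H ^ (-(1 / 2) : ℝ) *
            (Nat.card G : ℝ) ^ (-(5 / 4) + (2 * (ν : ℝ) + 1) / (4 * (ν : ℝ) * ((ν : ℝ) + 1))) +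
          (p : ℝ) ^ (5 / 2 - 1 / (2 * (ν : ℝ))) * H ^ (-1 : ℝ) *
            (Nat.card G : ℝ) ^ (-(5 / 4) + 1 / (2 * (ν : ℝ)))) := by
  obtain ⟨C, hC0, hC⟩ := exists_ncard_avoidingSet_sq_le hν (ε := 2 * ε) (by positivity)
  refine ⟨C + 1, by linarith, fun p hp G hG H hH ↦ ?_⟩
  have : Fact p.Prime := ⟨hp⟩
  have hp0 : (0 : ℝ) < p := by exact_mod_cast hp.pos
  have ht0 : (0 : ℝ) < Nat.card G := by exact_mod_cast Nat.card_pos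
  have hν0 : (0 : ℝ) < ν := by exact_mod_cast hν
  have hpt : p ≤ Nat.card G ^ 2 := by
    have h1 : ((p : ℝ) ^ (1 / 2 : ℝ)) ^ 2 ≤ (Nat.card G : ℝ) ^ 2 := by gcongr
    rw [← Real.sqrt_eq_rpow, Real.sq_sqrt hp0.le] at h1
    exact_mod_cast h1
  have hmain := hC p G hpt H hH
  have e1 := first_term_sq hp0 ht0 hH hν0
  have e2 := second_term_sq hp0 ht0 hH hν0
  set T₁ := (p : ℝ) ^ (2 - 1 / (4 * ((ν : ℝ) + 1))) * H ^ (-(1 / 2) : ℝ) *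
    (Nat.card G : ℝ) ^ (-(5 / 4) + (2 * (ν : ℝ) + 1) / (4 * (ν : ℝ) * ((ν : ℝ) + 1)))
  set T₂ := (p : ℝ) ^ (5 / 2 - 1 / (2 * (ν : ℝ))) * H ^ (-1 : ℝ) *
    (Nat.card G : ℝ) ^ (-(5 / 4) + 1 / (2 * (ν : ℝ)))
  have hT₁ : 0 ≤ T₁ := by positivity
  have hT₂ : 0 ≤ T₂ := by positivity
  have hfac : 0 < (Nat.card G : ℝ) ^ 2 * √(Nat.card G) := by positivity
  have hpε : (p : ℝ) ^ (2 * ε) = ((p : ℝ) ^ ε) ^ 2 := by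
    rw [← Real.rpow_natCast, ← Real.rpow_mul hp0.le]; congr 1; push_cast; ring
  have hsq : ((avoidingSet p G H).ncard : ℝ) ^ 2 ≤ C * ((p : ℝ) ^ ε) ^ 2 * (T₁ ^ 2 + T₂ ^ 2) := by
    refine le_of_mul_le_mul_right (hmain.trans (le_of_eq ?_)) hfac
    rw [mul_assoc _ (T₁ ^ 2 + T₂ ^ 2), add_mul, e1, e2, hpε]
    ring
  refine le_of_pow_le_pow_left₀ (n := 2) (by norm_num) (by positivity) (hsq.trans ?_)
  have h1 : T₁ ^ 2 + T₂ ^ 2 ≤ (T₁ + T₂) ^ 2 := by nlinarith [mul_nonneg hT₁ hT₂]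
  have h2 : C ≤ (C + 1) ^ 2 := by nlinarith
  calc C * ((p : ℝ) ^ ε) ^ 2 * (T₁ ^ 2 + T₂ ^ 2)
      ≤ (C + 1) ^ 2 * ((p : ℝ) ^ ε) ^ 2 * (T₁ + T₂) ^ 2 := by gcongr
    _ = ((C + 1) * (p : ℝ) ^ ε * (T₁ + T₂)) ^ 2 := by ring

theorem lemma4 (ν : ℕ) (hν : 1 ≤ ν) :
    ∃ δ : ℕ → ℝ, Tendsto δ atTop (𝓝 0) ∧
      ∀ p : ℕ, p.Prime →
      ∀ G : Subgroup (ZMod p)ˣ, (p : ℝ) ^ (1 / 2 : ℝ) < (Nat.card G : ℝ) →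
      ∀ H : ℝ, 0 < H →
        ((avoidingSet p G H).ncard : ℝ) ≤
          (p : ℝ) ^ (2 - 1 / (4 * ((ν : ℝ) + 1)) + δ p) * H ^ (-(1 / 2) : ℝ) *
              (Nat.card G : ℝ) ^
                (-(5 / 4) + (2 * (ν : ℝ) + 1) / (4 * (ν : ℝ) * ((ν : ℝ) + 1)))
            + (p : ℝ) ^ (5 / 2 - 1 / (2 * (ν : ℝ)) + δ p) * H ^ (-1 : ℝ) *
              (Nat.card G : ℝ) ^ (-(5 / 4) + 1 / (2 * (ν : ℝ))) := by
  choose c hc1 hc using fun k : ℕ ↦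
    exists_ncard_avoidingSet_le hν (ε := 1 / ((k : ℝ) + 1)) (by positivity)
  obtain ⟨δ, hδ, hδp⟩ := exists_tendsto_zero_mul_rpow_le hc1
  refine ⟨δ, hδ, fun p hp G hG H hH ↦ ?_⟩
  have hp0 : (0 : ℝ) < p := by exact_mod_cast hp.pos
  obtain ⟨k, hk⟩ := hδp p hp.two_le
  refine (hc k p hp G hG H hH).trans ?_
  rw [Real.rpow_add hp0 _ (δ p), Real.rpow_add hp0 _ (δ p)]
  refine (mul_le_mul_of_nonneg_right hk (by positivity)).trans (le_of_eq ?_)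
  ring
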